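/- Let $H\in(0,1)$ and let $(B^H_t)_{t\ge0}$ be a fractional Brownian motion with Hurst parameter $H$, i.e. a centered Gaussian process with continuous paths and covariance $\mathbb E[B^H_sB^H_t]=\tfrac12\left(t^{2H}+s^{2H}-|t-s|^{2H}\right)$. Let $\sigma\in C^\infty(\mathbb R)$ have bounded derivatives of all orders $\ge 1$, and let $x_0,y_0\in\mathbb R$ be such that $\sigma$ has no zero on the closed interval with endpoints $x_0$ and $y_0$ (for instance, $\sigma$ has no zero at all). Let $X=(X_t)_{t\ge0}$ and $Y=(Y_t)_{t\ge0}$ be solutions of $$dX_t=\sigma(X_t)\circ dB^H_t,\quad X_0=x_0,\qquad\qquad dY_t=\sigma(Y_t)\circ dB^H_t,\quad Y_0=y_0,$$ where the equations are understood in the pathwise sense: either almost surely in the sense of rough paths, with respect to the canonical one-dimensional geometric lift of $B^H$, whose $k$-th iterated integral over $[s,t]$ is $(B^H_t-B^H_s)^k/k!$ (this includes the sense of Young), or, for solutions of the form $f(B^H_t)$ with $f\in C^{4m+1}(\mathbb R)$, in the sense of the $m$-order Newton–Cotes functional for some $m\ge1$ with $(2m+1)H>1$. Then for every $t>0$ the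 random variables $X_t$ and $Y_t$ have continuous probability densities $f_{X_t}$ and $f_{Y_t}$, both densities are positive and $\ln(f_{X_t}/f_{Y_t})$ is differentiable at $X_t$ almost surely, the expectations $$K(X_t\|Y_t)=\mathbb E\left[\ln\frac{f_{X_t}(X_t)}{f_{Y_t}(X_t)}\right],\qquad J_{\sigma^2}(X_t\|Y_t)=\mathbb E\left[\sigma^2(X_t)\left(\frac{\partial}{\partial x}\ln\frac{f_{X_t}(X_t)}{f_{Y_t}(X_t)}\right)^2\right]$$ (the Kullback–Leibler divergence and the relative Fisher information with respect to $\sigma^2$) are finite, $t\mapsto K(X_t\|Y_t)$ is differentiable at $t$, and $$\frac{d}{dt}K(X_t\|Y_t)=-H\,t^{2H-1}J_{\sigma^2}(X_t\|Y_t).$$ In particular, $K(X_t\|Y_t)$ is non-increasing in $t\in(0,\infty)$. -/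

import Mathlib

open MeasureTheory ProbabilityTheory Filter Topology
open scoped NNReal ENNReal

noncomputable section

/-- `B` is a fractional Brownian motion with Hurst parameter `H`: a centered Gaussian process with
continuous paths and the covariance function of fBm. (Stationarity of the increments is a
consequence of the covariance function, so it is not repeated.) -/
structure IsFractionalBrownianMotion {Ω : Type*} [MeasurableSpace Ω] (P : Measure Ω) (H : ℝ)
    (B : ℝ≥0 → Ω → ℝ) : Prop where
  isGaussianProcess : IsGaussianProcess B P
  centered : ∀ t, ∫ ω, B t ω ∂P = 0
  covariance : ∀ s t : ℝ≥0, ∫ ω, B s ω * B t ω ∂P =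
    ((t : ℝ) ^ (2 * H) + (s : ℝ) ^ (2 * H) - |(t : ℝ) - (s : ℝ)| ^ (2 * H)) / 2
  continuous_paths : ∀ᵐ ω ∂P, Continuous fun t => B t ω

/-- The iterated vector fields `V₀ = id`, `V₁ = σ`, `V₂ = σ σ'`, `V₃ = σ (σ σ')'`, ... -/
def iterVectorField (σ : ℝ → ℝ) : ℕ → ℝ → ℝ
  | 0 => id
  | k + 1 => fun x => σ x * deriv (iterVectorField σ k) x

/-- The path `x` solves `dx = σ(x) ∘ dw`, `x 0 = x₀`, in the rough path sense (in Davie's form),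
where the locally `α`-Hölder path `w` is lifted to its canonical geometric rough path, whose `k`-th
iterated integral over `[s, t]` is `(w t - w s) ^ k / k!`. For `α > 1 / 2` one may take `N = 1`,
and the equation is then the one in the sense of Young. -/
def IsRoughSolution (σ : ℝ → ℝ) (x₀ : ℝ) (w x : ℝ≥0 → ℝ) : Prop :=
  x 0 = x₀ ∧
  ∃ (α : ℝ) (N : ℕ), 0 < α ∧ 1 < (N + 1) * α ∧
    ∀ T : ℝ≥0,
      (∃ C : ℝ, ∀ s t : ℝ≥0, s ≤ t → t ≤ T → |w t - w s| ≤ C * ((t : ℝ) - s) ^ α) ∧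
      ∃ θ C : ℝ, 1 < θ ∧ ∀ s t : ℝ≥0, s ≤ t → t ≤ T →
        |x t - ∑ k ∈ Finset.range (N + 1),
            iterVectorField σ k (x s) * (w t - w s) ^ k / (k.factorial : ℝ)|
          ≤ C * ((t : ℝ) - s) ^ θ

/-- Number of subintervals of the Newton–Cotes rule of order `m`: trapezoidal rule for `m = 1`,
Simpson's rule for `m = 2`, in general `2 m - 2` subintervals for `m ≥ 2`. -/
def newtonCotesSub (m : ℕ) : ℕ := if m = 1 then 1 else 2 * m - 2

/-- The weight of the node `j / n` in the closed Newton–Cotes rule on `[0, 1]` with nodes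
`0, 1 / n, ..., 1`: the integral of the Lagrange basis polynomial. -/
def newtonCotesWeight (n j : ℕ) : ℝ :=
  ∫ u in (0 : ℝ)..1, ∏ k ∈ (Finset.range (n + 1)).erase j, ((n : ℝ) * u - k) / ((j : ℝ) - k)

/-- The `ε`-approximation
`ε⁻¹ ∫₀ᵗ (w (s + ε) - w s) (∫ g (w s + a (w (s + ε) - w s)) ν_m(da)) ds`
of the Newton–Cotes functional `∫₀ᵗ g(w) ∘ dw` of order `m`, where `ν_m` is the
Newton–Cotes quadrature measure of order `m` on `[0, 1]`. -/
def newtonCotesApprox (m : ℕ) (g : ℝ → ℝ) (w : ℝ≥0 → ℝ) (t : ℝ≥0) (ε : ℝ) : ℝ :=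
  ε⁻¹ * ∫ s in (0 : ℝ)..(t : ℝ),
    (w (s + ε).toNNReal - w s.toNNReal) *
      ∑ j ∈ Finset.range (newtonCotesSub m + 1), newtonCotesWeight (newtonCotesSub m) j *
        g (w s.toNNReal + (j : ℝ) / (newtonCotesSub m : ℝ) * (w (s + ε).toNNReal - w s.toNNReal))

/-- The process `X` solves `dX = σ(X) ∘ dB`, `X₀ = x₀`, where the integral is the Newton–Cotes
functional of order `m` (a limit in probability). That functional is defined for integrands that
are functions of the current value of `B`, so `X` is sought in the form `X t = f (B t)`. -/
def IsNewtonCotesSolution {Ω : Type*} [MeasurableSpace Ω] (P : Measure Ω) (m : ℕ) (σ : ℝ → ℝ)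
    (x₀ : ℝ) (B X : ℝ≥0 → Ω → ℝ) : Prop :=
  ∃ f : ℝ → ℝ, ContDiff ℝ ((4 * m + 1 : ℕ) : WithTop ℕ∞) f ∧
    (∀ t, ∀ᵐ ω ∂P, X t ω = f (B t ω)) ∧
    ∀ t, TendstoInMeasure P
      (fun (ε : ℝ) ω => newtonCotesApprox m (fun b => σ (f b)) (fun s => B s ω) t ε)
      (𝓝[>] (0 : ℝ)) (fun ω => X t ω - x₀)

/-- The process `X` is a solution of the equation `dX = σ(X) ∘ dB`, `X₀ = x₀`, driven by the
fractional Brownian motion `B` with Hurst parameter `H`, the integral being understood in the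
pathwise sense: either almost every path solves the equation in the rough path sense (which
includes the sense of Young), or `X` solves it in the sense of Newton–Cotes functionals of some
order `m` that is high enough for `H`. -/
def IsPathwiseSolution {Ω : Type*} [MeasurableSpace Ω] (P : Measure Ω) (H : ℝ) (σ : ℝ → ℝ)
    (x₀ : ℝ) (B X : ℝ≥0 → Ω → ℝ) : Prop :=
  (∀ᵐ ω ∂P, IsRoughSolution σ x₀ (fun t => B t ω) (fun t => X t ω)) ∨
  ∃ m : ℕ, 1 ≤ m ∧ 1 < (2 * m + 1) * H ∧ IsNewtonCotesSolution P m σ x₀ B X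

/-- `f` is the continuous probability density function of the random variable `X`. -/
structure IsContinuousDensity {Ω : Type*} [MeasurableSpace Ω] (P : Measure Ω) (X : Ω → ℝ)
    (f : ℝ → ℝ) : Prop where
  aemeasurable : AEMeasurable X P
  continuous : Continuous f
  nonneg : ∀ x, 0 ≤ f x
  map_eq : P.map X = volume.withDensity fun x => ENNReal.ofReal (f x)

theorem IsContinuousDensity.unique {Ω : Type*} [MeasurableSpace Ω] {P : Measure Ω} {X : Ω → ℝ}
    {f g : ℝ → ℝ} (hf : IsContinuousDensity P X f) (hg : IsContinuousDensity P X g) : f = g := by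
  have h := hf.map_eq.symm.trans hg.map_eq
  have hfm : AEMeasurable (fun x => ENNReal.ofReal (f x)) volume :=
    hf.continuous.measurable.ennreal_ofReal.aemeasurable
  have hgm : AEMeasurable (fun x => ENNReal.ofReal (g x)) volume :=
    hg.continuous.measurable.ennreal_ofReal.aemeasurable
  rw [withDensity_eq_iff_of_sigmaFinite hfm hgm] at h
  refine (hf.continuous.ae_eq_iff_eq volume hg.continuous).1 ?_
  filter_upwards [h] with x hx
  exact (ENNReal.ofReal_eq_ofReal_iff (hf.nonneg x) (hg.nonneg x)).1 hx

open Classical in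
/-- The continuous probability density function `f_X` of `X` (zero if there is none). -/
def densityOf {Ω : Type*} [MeasurableSpace Ω] (P : Measure Ω) (X : Ω → ℝ) : ℝ → ℝ :=
  if h : ∃ f, IsContinuousDensity P X f then h.choose else 0

theorem IsContinuousDensity.densityOf_eq {Ω : Type*} [MeasurableSpace Ω] {P : Measure Ω}
    {X : Ω → ℝ} {f : ℝ → ℝ} (hf : IsContinuousDensity P X f) : densityOf P X = f := by
  have h : ∃ f, IsContinuousDensity P X f := ⟨f, hf⟩
  rw [densityOf, dif_pos h]
  exact h.choose_spec.unique hf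

/-- The log-likelihood ratio `ln (f_X / f_Y)`. -/
def logRatio {Ω : Type*} [MeasurableSpace Ω] (P : Measure Ω) (X Y : Ω → ℝ) : ℝ → ℝ :=
  fun x => Real.log (densityOf P X x / densityOf P Y x)

/-- The Kullback–Leibler divergence `K(X‖Y) = E[ln (f_X(X) / f_Y(X))]`. -/
def klDivergence {Ω : Type*} [MeasurableSpace Ω] (P : Measure Ω) (X Y : Ω → ℝ) : ℝ :=
  ∫ ω, logRatio P X Y (X ω) ∂P

/-- The relative Fisher information `J_b(X‖Y) = E[b(X) (∂ₓ ln (f_X / f_Y) (X))²]`. -/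
def relativeFisherInfo {Ω : Type*} [MeasurableSpace Ω] (P : Measure Ω) (b : ℝ → ℝ)
    (X Y : Ω → ℝ) : ℝ :=
  ∫ ω, b (X ω) * (deriv (logRatio P X Y) (X ω)) ^ 2 ∂P

end

/-!
The equations are one-dimensional and driven by geometric integrals, so the solutions are explicit.
If `Ψ` is the flow of `y' = σ(y)` (global, since `σ` is Lipschitz), then `X t = Ψ (B t) x₀` and
`Y t = Ψ (B t) y₀` almost surely (`IsPathwiseSolution.ae_eq_flow`).

* In the rough path sense, the Davie expansion of a solution is the Taylor expansion of the flow, so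
  pulling a solution back by the flow gives a path with increments of order greater than one, which
  is constant (`IsRoughSolution.eq_flow`).
* In the Newton–Cotes sense, the solution is `f (B t)`. The rule of order `m` is exact in degrees
  below `2 m`, so the integral of `σ ∘ f` is the increment of a primitive `F` of `σ ∘ f`, up to the
  `(2 m + 1)`-th variation of `B`, which vanishes because `(2 m + 1) H > 1`
  (`tendsto_newtonCotesApprox`, `tendstoInMeasure_variation`). As `B 1` has full support, this gives
  `f = x₀ + F`, that is `f' = σ ∘ f` with `f 0 = x₀`
  (`IsNewtonCotesSolution.ae_eq_flow`).

Since `σ` has no zero between `x₀` and `y₀`, there is `c` with `y₀ = Ψ c x₀` (`IsFlow.exists_eq`).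
Hence `X t` and `Y t` are the images of `B t` and `B t + c` under one and the same open embedding
`φ = Ψ · x₀`, and their densities at `φ u` are the Gaussian ones divided by `|σ (φ u)|`. They extend
continuously by zero outside the range of `φ`, because `|σ (φ u)|` decays at most exponentially in
`|u|`. The Jacobian cancels in the likelihood ratio: with `v = t ^ (2 H)`,

  `ln (f_X / f_Y) (φ u) = (c² - 2 u c) / (2 v)`,

so that `K = c² / (2 v)`, and `J = c² / v²` because `σ² (φ u)` cancels the square of the derivative
of `φ`. The identity is then the derivative of `t ↦ c² / (2 t ^ (2 H))`.
-/

/-! ### The flow of a Lipschitz vector field on the line -/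

/-- `Ψ` is the global flow of the autonomous equation `y' = σ(y)` on the line: `Ψ b y` is the
position at time `b` of the solution started at `y`. -/
structure IsFlow (σ : ℝ → ℝ) (Ψ : ℝ → ℝ → ℝ) : Prop where
  zero : ∀ y, Ψ 0 y = y
  hasDerivAt : ∀ b y, HasDerivAt (fun u => Ψ u y) (σ (Ψ b y)) b

/-- A Lipschitz `C¹` vector field on the line is complete. -/
theorem LipschitzWith.exists_integralCurve {σ : ℝ → ℝ} {K : ℝ≥0} (hL : LipschitzWith K σ)
    (hc : ContDiff ℝ 1 σ) (y : ℝ) :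
    ∃ γ : ℝ → ℝ, γ 0 = y ∧ ∀ t, HasDerivAt γ (σ (γ t)) t := by
  have hv : ContMDiff (modelWithCornersSelf ℝ ℝ) (modelWithCornersSelf ℝ ℝ).tangent 1
      (fun x : ℝ => (⟨x, (σ x : TangentSpace (modelWithCornersSelf ℝ ℝ) x)⟩ :
        TangentBundle (modelWithCornersSelf ℝ ℝ) ℝ)) := by
    exact contMDiff_vectorSpace_iff_contDiff.2 hc
  have hε : (0 : ℝ) < 1 / (2 * (K + 1)) := by positivity
  -- On the ball of radius `r = |σ x| + 1` the speed is at most `(K + 1) r`, so a solution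
  -- started at the centre stays inside for the time `1 / (2 (K + 1))`, whatever the centre is.
  have hloc : ∀ x : ℝ, ∃ γ : ℝ → ℝ, γ 0 = x ∧
      ∀ t ∈ Set.Ioo (-(1 / (2 * (K + 1) : ℝ))) (1 / (2 * (K + 1) : ℝ)),
        HasDerivAt γ (σ (γ t)) t := by
    intro x
    set r : ℝ≥0 := ‖σ x‖₊ + 1 with hr
    set ε : ℝ := 1 / (2 * (K + 1) : ℝ) with hεdef
    have h0 : (0 : ℝ) ∈ Set.Icc (-ε) ε := ⟨by linarith, hε.le⟩
    have hPL : IsPicardLindelof (fun _ => σ) (⟨0, h0⟩ : Set.Icc (-ε) ε) x r 0 ((K + 1) * r) K := by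
      refine IsPicardLindelof.of_time_independent (fun z hz => ?_) hL.lipschitzOnWith ?_
      · have h1 : ‖σ z - σ x‖ ≤ K * ‖z - x‖ := hL.norm_sub_le z x
        have h2 : ‖z - x‖ ≤ r := by simpa [dist_eq_norm] using hz
        have h3 : ‖σ z‖ ≤ ‖σ z - σ x‖ + ‖σ x‖ := by
          simpa using norm_add_le (σ z - σ x) (σ x)
        have h4 : (r : ℝ) = ‖σ x‖ + 1 := by simp [hr]
        have h5 : (K : ℝ) * ‖z - x‖ ≤ K * r := by gcongr
        push_cast
        linarith
      · have : ((K : ℝ) + 1) * r * ε = r / 2 := by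
          rw [hεdef]; field_simp
        simp only [sub_zero, zero_sub, neg_neg, max_self, NNReal.coe_mul, NNReal.coe_add,
          NNReal.coe_one, NNReal.coe_zero]
        rw [this]
        have := r.coe_nonneg
        linarith
    obtain ⟨γ, hγ0, hγ⟩ := hPL.exists_eq_forall_mem_Icc_hasDerivWithinAt₀
    exact ⟨γ, hγ0, fun t ht => (hγ t ⟨ht.1.le, ht.2.le⟩).hasDerivAt (Icc_mem_nhds ht.1 ht.2)⟩
  obtain ⟨γ, hγ0, hγ⟩ := exists_isMIntegralCurve_of_isMIntegralCurveOn
    (I := modelWithCornersSelf ℝ ℝ) (M := ℝ) (v := fun x => σ x) hv hε (fun x => by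
      obtain ⟨γ, h0, h⟩ := hloc x
      exact ⟨γ, h0, fun t ht => (h t ht).hasFDerivAt.hasMFDerivAt.hasMFDerivWithinAt⟩) y
  exact ⟨γ, hγ0, fun t => (hγ t).hasFDerivAt⟩

theorem exists_isFlow {σ : ℝ → ℝ} {K : ℝ≥0} (hL : LipschitzWith K σ) (hc : ContDiff ℝ 1 σ) :
    ∃ Ψ, IsFlow σ Ψ := by
  choose γ h0 h using fun y => hL.exists_integralCurve hc y
  exact ⟨fun b y => γ y b, h0, fun b y => h y b⟩

namespace IsFlow

variable {σ : ℝ → ℝ} {Ψ : ℝ → ℝ → ℝ} {K : ℝ≥0}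

theorem continuous (h : IsFlow σ Ψ) (y : ℝ) : Continuous fun u => Ψ u y :=
  continuous_iff_continuousAt.2 fun b => (h.hasDerivAt b y).continuousAt

theorem eq_of_hasDerivAt (h : IsFlow σ Ψ) (hL : LipschitzWith K σ) {γ : ℝ → ℝ}
    (hγ : ∀ b, HasDerivAt γ (σ (γ b)) b) (b : ℝ) : γ b = Ψ b (γ 0) := by
  have := ODE_solution_unique_univ (v := fun _ => σ) (s := fun _ => Set.univ) (t₀ := 0)
    (f := γ) (g := fun u => Ψ u (γ 0))
    (fun _ => hL.lipschitzOnWith) (fun t => ⟨hγ t, trivial⟩)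
    (fun t => ⟨h.hasDerivAt t _, trivial⟩) (h.zero _).symm
  exact congrFun this b

theorem add (h : IsFlow σ Ψ) (hL : LipschitzWith K σ) (a b y : ℝ) :
    Ψ (a + b) y = Ψ a (Ψ b y) := by
  have := h.eq_of_hasDerivAt hL (γ := fun u => Ψ (u + b) y)
    (fun u => (h.hasDerivAt (u + b) y).comp_add_const u b) a
  simpa using this

theorem neg_self (h : IsFlow σ Ψ) (hL : LipschitzWith K σ) (b y : ℝ) : Ψ (-b) (Ψ b y) = y := by
  rw [← h.add hL, neg_add_cancel, h.zero]

theorem neg (h : IsFlow σ Ψ) : IsFlow (fun x => -σ x) (fun b y => Ψ (-b) y) := by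
  refine ⟨fun y => by simp [h.zero], fun b y => ?_⟩
  simpa [Function.comp_def] using (h.hasDerivAt (-b) y).scomp b (hasDerivAt_neg b)

theorem abs_sub_le (h : IsFlow σ Ψ) (hL : LipschitzWith K σ) (b y z : ℝ) :
    |Ψ b y - Ψ b z| ≤ |y - z| * Real.exp (K * |b|) := by
  have key : ∀ {σ : ℝ → ℝ} {Ψ : ℝ → ℝ → ℝ}, IsFlow σ Ψ → LipschitzWith K σ → ∀ b, 0 ≤ b →
      |Ψ b y - Ψ b z| ≤ |y - z| * Real.exp (K * |b|) := by
    intro σ Ψ h hL b hb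
    have := dist_le_of_trajectories_ODE (v := fun _ => σ) (a := 0) (b := b) (δ := |y - z|)
      (fun _ => hL) (h.continuous y).continuousOn
      (fun t _ => (h.hasDerivAt t y).hasDerivWithinAt) (h.continuous z).continuousOn
      (fun t _ => (h.hasDerivAt t z).hasDerivWithinAt)
      (by simp [h.zero, Real.dist_eq]) b ⟨hb, le_rfl⟩
    simpa [Real.dist_eq, abs_of_nonneg hb] using this
  rcases le_total 0 b with hb | hb
  · exact key h hL b hb
  · simpa using key h.neg hL.neg (-b) (by linarith)

theorem field_ne_zero (h : IsFlow σ Ψ) (hL : LipschitzWith K σ) {y : ℝ} (hy : σ y ≠ 0) (b : ℝ) :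
    σ (Ψ b y) ≠ 0 := by
  intro h0
  have h1 := h.eq_of_hasDerivAt hL (γ := fun _ => Ψ b y)
    (fun u => by simpa [h0] using hasDerivAt_const u (Ψ b y)) (-b)
  rw [h.neg_self hL] at h1
  exact hy (h1 ▸ h0)

/-- The field decays at most exponentially along a flow line: moving two nearby points back by the
flow expands their distance at most by the factor `exp (K |b|)`. -/
theorem abs_field_le_exp_mul (h : IsFlow σ Ψ) (hL : LipschitzWith K σ) (b y : ℝ) :
    |σ y| ≤ Real.exp (K * |b|) * |σ (Ψ b y)| := by
  have h1 := (hasDerivAt_iff_tendsto_slope_zero.1 (h.hasDerivAt 0 y)).abs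
  have h2 := ((hasDerivAt_iff_tendsto_slope_zero.1 (h.hasDerivAt b y)).abs).const_mul
    (Real.exp (K * |b|))
  rw [h.zero] at h1
  refine le_of_tendsto_of_tendsto h1 h2 (Eventually.of_forall fun u => ?_)
  have h3 := h.abs_sub_le hL (-b) (Ψ (b + u) y) (Ψ b y)
  rw [h.neg_self hL, ← h.add hL, neg_add_cancel_left, abs_neg] at h3
  simp only [zero_add, smul_eq_mul, abs_mul]
  calc |u⁻¹| * |Ψ u y - y| ≤ |u⁻¹| * (|Ψ (b + u) y - Ψ b y| * Real.exp (K * |b|)) := by gcongr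
    _ = _ := by ring

theorem injective (h : IsFlow σ Ψ) (hL : LipschitzWith K σ) {y : ℝ} (hy : σ y ≠ 0) :
    Function.Injective fun b => Ψ b y := by
  intro a b hab
  by_contra hne
  wlog hlt : a < b generalizing a b
  · exact this hab.symm (Ne.symm hne) (lt_of_le_of_ne (not_lt.1 hlt) (Ne.symm hne))
  obtain ⟨c, -, hc⟩ := exists_deriv_eq_zero hlt (h.continuous y).continuousOn hab
  rw [(h.hasDerivAt c y).deriv] at hc
  exact h.field_ne_zero hL hy c hc

theorem isOpenEmbedding (h : IsFlow σ Ψ) (hL : LipschitzWith K σ) {y : ℝ} (hy : σ y ≠ 0) :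
    IsOpenEmbedding fun b => Ψ b y := by
  have hd : deriv (fun b => Ψ b y) = fun b => σ (Ψ b y) :=
    funext fun b => (h.hasDerivAt b y).deriv
  have hc1 : ContDiff ℝ 1 fun b => Ψ b y :=
    contDiff_one_iff_deriv.2 ⟨fun b => (h.hasDerivAt b y).differentiableAt, by
      rw [hd]; exact hL.continuous.comp (h.continuous y)⟩
  refine IsOpenEmbedding.of_continuous_injective_isOpenMap (h.continuous y) (h.injective hL hy)
    (isOpenMap_of_hasStrictDerivAt (f' := fun b => σ (Ψ b y)) (fun b => ?_)
      (h.field_ne_zero hL hy))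
  rw [← congrFun hd b]
  exact hc1.contDiffAt.hasStrictDerivAt one_ne_zero

/-- The flow line through `x₀` reaches every point that is not separated from `x₀` by a zero of
the field. -/
theorem exists_eq (h : IsFlow σ Ψ) (hL : LipschitzWith K σ) {x₀ y₀ : ℝ}
    (h0 : ∀ z ∈ Set.uIcc x₀ y₀, σ z ≠ 0) : ∃ c, Ψ c x₀ = y₀ := by
  -- Along the segment `q s = x₀ + s (y₀ - x₀)`, the time change with the speed
  -- `ρ s = (y₀ - x₀) / σ (q s)` turns the flow line into a solution of `p' = ρ σ(p)`;
  -- the segment itself is another one.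
  set q : ℝ → ℝ := fun s => x₀ + (max 0 (min s 1)) * (y₀ - x₀) with hq
  have hqmem : ∀ s, q s ∈ Set.uIcc x₀ y₀ := by
    intro s
    have h1 : (0 : ℝ) ≤ max 0 (min s 1) := le_max_left _ _
    have h2 : max 0 (min s 1) ≤ (1 : ℝ) := max_le zero_le_one (min_le_right _ _)
    rw [Set.mem_uIcc]
    rcases le_total x₀ y₀ with h | h
    · left; constructor <;> simp only [hq] <;> nlinarith
    · right; constructor <;> simp only [hq] <;> nlinarith
  have hqc : Continuous q := by fun_prop
  set ρ : ℝ → ℝ := fun s => (y₀ - x₀) / σ (q s) with hρ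
  have hρc : Continuous ρ :=
    continuous_const.div (hL.continuous.comp hqc) fun s => h0 _ (hqmem s)
  obtain ⟨M, hM⟩ : ∃ M : ℝ≥0, ∀ s ∈ Set.Icc (0 : ℝ) 1, ‖ρ s‖ ≤ M := by
    obtain ⟨M, hM⟩ := isCompact_Icc.exists_bound_of_continuousOn (s := Set.Icc (0 : ℝ) 1)
      hρc.continuousOn
    exact ⟨M.toNNReal, fun s hs => (hM s hs).trans (Real.le_coe_toNNReal M)⟩
  set τ : ℝ → ℝ := fun s => ∫ r in (0 : ℝ)..s, ρ r with hτ
  have hτd : ∀ s, HasDerivAt τ (ρ s) s := fun s => hρc.integral_hasStrictDerivAt 0 s |>.hasDerivAt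
  have hpd : ∀ s, HasDerivAt (fun s => Ψ (τ s) x₀) (ρ s * σ (Ψ (τ s) x₀)) s := fun s => by
    simpa [mul_comm, Function.comp_def] using (h.hasDerivAt (τ s) x₀).comp s (hτd s)
  have hlin : ∀ s, HasDerivAt (fun s : ℝ => x₀ + s * (y₀ - x₀)) (y₀ - x₀) s := fun s => by
    simpa using ((hasDerivAt_id s).mul_const (y₀ - x₀)).const_add x₀
  have hEq := ODE_solution_unique_of_mem_Icc_right (a := 0) (b := 1) (K := M * K)
    (v := fun s x => ρ s * σ x) (s := fun _ => Set.univ)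
    (f := fun s => Ψ (τ s) x₀) (g := fun s => x₀ + s * (y₀ - x₀))
    (fun s hs => LipschitzWith.lipschitzOnWith <| LipschitzWith.of_dist_le_mul fun x y => by
      rw [dist_eq_norm, ← mul_sub, norm_mul, NNReal.coe_mul, mul_assoc]
      exact mul_le_mul (hM s ⟨hs.1, hs.2.le⟩) (hL.dist_le_mul x y) (norm_nonneg _) M.2)
    (fun s _ => (hpd s).continuousAt.continuousWithinAt)
    (fun s _ => (hpd s).hasDerivWithinAt) (fun _ _ => trivial)
    (fun s _ => (hlin s).continuousAt.continuousWithinAt)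
    (fun s hs => by
      have hs' : q s = x₀ + s * (y₀ - x₀) := by
        simp only [hq]; rw [min_eq_left hs.2.le, max_eq_right hs.1]
      have h2 : ρ s * σ (x₀ + s * (y₀ - x₀)) = y₀ - x₀ := by
        rw [← hs']; exact div_mul_cancel₀ _ (h0 _ (hqmem s))
      change HasDerivWithinAt _ (ρ s * σ (x₀ + s * (y₀ - x₀))) _ _
      rw [h2]
      exact (hlin s).hasDerivWithinAt)
    (fun _ _ => trivial) (by simp [hτ, h.zero])
  refine ⟨τ 1, ?_⟩
  have := hEq (Set.right_mem_Icc.2 zero_le_one)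
  simpa using this

end IsFlow

/-! ### Taylor's formula and rough differential equations -/

/-- Taylor's formula for a tower `F 0, F 1, …` of successive derivatives, with a remainder bound
that does not favour one side of the base point. -/
theorem abs_sub_taylor_le {n : ℕ} {F : ℕ → ℝ → ℝ} {a b M : ℝ}
    (hF : ∀ k ≤ n, ∀ u ∈ Set.uIcc a b, HasDerivAt (F k) (F (k + 1) u) u)
    (hM : ∀ u ∈ Set.uIcc a b, |F (n + 1) u| ≤ M) :
    |F 0 b - ∑ k ∈ Finset.range (n + 1), F k a * (b - a) ^ k / (k.factorial : ℝ)|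
      ≤ M * |b - a| ^ (n + 1) := by
  have hM0 : 0 ≤ M := (abs_nonneg _).trans (hM a Set.left_mem_uIcc)
  induction n generalizing F b with
  | zero =>
    have := (convex_uIcc a b).norm_image_sub_le_of_norm_hasDerivWithin_le (f := F 0)
      (fun u hu => (hF 0 le_rfl u hu).hasDerivWithinAt) hM Set.left_mem_uIcc Set.right_mem_uIcc
    simpa using this
  | succ n ih =>
    set G : ℝ → ℝ := fun u =>
      F 0 u - ∑ k ∈ Finset.range (n + 2), F k a * (u - a) ^ k / (k.factorial : ℝ) with hG
    have hsub : ∀ u ∈ Set.uIcc a b, Set.uIcc a u ⊆ Set.uIcc a b := fun u hu =>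
      Set.uIcc_subset_uIcc_left hu
    have hGd : ∀ u ∈ Set.uIcc a b, HasDerivAt G
        (F 1 u - ∑ k ∈ Finset.range (n + 1), F (k + 1) a * (u - a) ^ k / (k.factorial : ℝ)) u := by
      intro u hu
      refine (hF 0 (Nat.zero_le _) u hu).sub ?_
      simp_rw [Finset.sum_range_succ' _ (n + 1)]
      have : HasDerivAt (fun u => ∑ k ∈ Finset.range (n + 1),
          F (k + 1) a * (u - a) ^ (k + 1) / ((k + 1).factorial : ℝ))
          (∑ k ∈ Finset.range (n + 1), F (k + 1) a * (u - a) ^ k / (k.factorial : ℝ)) u := by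
        refine HasDerivAt.fun_sum fun k _ => ?_
        have h1 := ((((hasDerivAt_id u).sub_const a).pow (k + 1)).const_mul (F (k + 1) a)).div_const
          ((k + 1).factorial : ℝ)
        refine h1.congr_deriv ?_
        have : (k.factorial : ℝ) ≠ 0 := by positivity
        simp only [Nat.factorial_succ, Nat.cast_mul, id, Nat.add_sub_cancel]
        field_simp
      simpa using this.add_const (F 0 a)
    have hGb : ∀ u ∈ Set.uIcc a b, ‖F 1 u - ∑ k ∈ Finset.range (n + 1),
        F (k + 1) a * (u - a) ^ k / (k.factorial : ℝ)‖ ≤ M * |b - a| ^ (n + 1) := by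
      intro u hu
      have h1 := ih (F := fun k => F (k + 1)) (b := u)
        (fun k hk v hv => hF (k + 1) (by omega) v (hsub u hu hv)) (fun v hv => hM v (hsub u hu hv))
      refine h1.trans ?_
      gcongr M * ?_ ^ (n + 1)
      exact Set.abs_sub_left_of_mem_uIcc hu
    have h2 := (convex_uIcc a b).norm_image_sub_le_of_norm_hasDerivWithin_le (f := G)
      (fun u hu => (hGd u hu).hasDerivWithinAt) hGb Set.left_mem_uIcc Set.right_mem_uIcc
    have hGa : G a = 0 := by
      simp only [hG, sub_self]
      rw [Finset.sum_range_succ']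
      simp
    rw [hGa, sub_zero, mul_assoc, Real.norm_eq_abs, Real.norm_eq_abs, ← pow_succ] at h2
    exact h2

theorem contDiff_iterVectorField {σ : ℝ → ℝ} (hσ : ContDiff ℝ ((⊤ : ℕ∞) : WithTop ℕ∞) σ) (k : ℕ) :
    ContDiff ℝ ((⊤ : ℕ∞) : WithTop ℕ∞) (iterVectorField σ k) := by
  induction k with
  | zero => exact contDiff_id
  | succ k ih =>
    refine hσ.mul ?_
    exact (contDiff_infty_iff_deriv.1 ih).2

/-- The iterated vector fields are the successive time derivatives of the flow. -/
theorem IsFlow.hasDerivAt_iterVectorField {σ : ℝ → ℝ} {Ψ : ℝ → ℝ → ℝ} (h : IsFlow σ Ψ)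
    (hσ : ContDiff ℝ ((⊤ : ℕ∞) : WithTop ℕ∞) σ) (k : ℕ) (b y : ℝ) :
    HasDerivAt (fun u => iterVectorField σ k (Ψ u y)) (iterVectorField σ (k + 1) (Ψ b y)) b := by
  have h1 : HasDerivAt (iterVectorField σ k) (deriv (iterVectorField σ k) (Ψ b y)) (Ψ b y) :=
    ((contDiff_iterVectorField hσ k).differentiable (by simp) _).hasDerivAt
  have h2 := h1.comp b (h.hasDerivAt b y)
  rw [mul_comm] at h2
  exact h2

/-- A function whose increments are `O(|t - s| ^ θ)` with `θ > 1` is constant. -/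
theorem eq_of_abs_sub_le_rpow {h : ℝ≥0 → ℝ} {T : ℝ≥0} {C D θ η : ℝ} (hθ : 1 < θ) (hη : 1 < η)
    (hh : ∀ s t : ℝ≥0, s ≤ t → t ≤ T →
      |h t - h s| ≤ C * ((t : ℝ) - s) ^ θ + D * ((t : ℝ) - s) ^ η) : h T = h 0 := by
  have key : ∀ n : ℕ, 0 < n → |h T - h 0| ≤
      C * (T : ℝ) ^ θ * (n : ℝ) ^ (-(θ - 1)) + D * (T : ℝ) ^ η * (n : ℝ) ^ (-(η - 1)) := by
    intro n hn
    have hn' : (0 : ℝ) < n := Nat.cast_pos.2 hn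
    have hstep : ∀ k : ℕ, k ≤ n → |h (T * (k / n)) - h 0| ≤
        k * (C * ((T : ℝ) / n) ^ θ + D * ((T : ℝ) / n) ^ η) := by
      intro k
      induction k with
      | zero => simp
      | succ k ih =>
        intro hk
        have h1 := ih (by omega)
        have hle : (T * ((k : ℝ≥0) / n) : ℝ≥0) ≤ T * (((k + 1 : ℕ) : ℝ≥0) / n) := by
          gcongr; omega
        have hle' : (T * (((k + 1 : ℕ) : ℝ≥0) / n) : ℝ≥0) ≤ T := by
          apply mul_le_of_le_one_right (by positivity)
          apply div_le_one_of_le₀ _ (by positivity)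
          exact_mod_cast hk
        have h2 := hh _ _ hle hle'
        have h3 : ((T * (((k + 1 : ℕ) : ℝ≥0) / n) : ℝ≥0) : ℝ) - ((T * ((k : ℝ≥0) / n) : ℝ≥0) : ℝ)
            = (T : ℝ) / n := by
          push_cast; field_simp; ring
        rw [h3] at h2
        have h4 := abs_sub_le (h (T * (((k + 1 : ℕ) : ℝ≥0) / n))) (h (T * ((k : ℝ≥0) / n))) (h 0)
        have h5 : ((k + 1 : ℕ) : ℝ) = k + 1 := by push_cast; ring
        rw [h5]
        linarith
    have h1 := hstep n le_rfl
    have hnn : (n : ℝ≥0) / n = 1 := div_self (by exact_mod_cast hn.ne')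
    rw [hnn, mul_one] at h1
    refine h1.trans (le_of_eq ?_)
    have hpow : ∀ x : ℝ, (n : ℝ) * ((T : ℝ) / n) ^ x = (T : ℝ) ^ x * (n : ℝ) ^ (-(x - 1)) := by
      intro x
      rw [Real.div_rpow T.coe_nonneg hn'.le, neg_sub, Real.rpow_sub hn', Real.rpow_one]
      ring
    linear_combination C * hpow θ + D * hpow η
  have hlim : Tendsto (fun n : ℕ => C * (T : ℝ) ^ θ * (n : ℝ) ^ (-(θ - 1)) +
      D * (T : ℝ) ^ η * (n : ℝ) ^ (-(η - 1))) atTop (𝓝 (C * (T : ℝ) ^ θ * 0 +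
      D * (T : ℝ) ^ η * 0)) :=
    (((tendsto_rpow_neg_atTop (by linarith)).comp tendsto_natCast_atTop_atTop).const_mul _).add
    (((tendsto_rpow_neg_atTop (by linarith)).comp tendsto_natCast_atTop_atTop).const_mul _)
  have := ge_of_tendsto hlim (eventually_atTop.2 ⟨1, fun n hn => key n hn⟩)
  simp only [mul_zero, add_zero] at this
  exact sub_eq_zero.1 (abs_eq_zero.1 (le_antisymm this (abs_nonneg _)))

/-- A solution in Davie's sense with respect to the canonical lift of `w` is the flow evaluated
along `w`: pulling the solution back by the flow gives a path with increments of order greater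
than one, hence a constant one. -/
theorem IsRoughSolution.eq_flow {σ : ℝ → ℝ} {Ψ : ℝ → ℝ → ℝ} {K : ℝ≥0} (h : IsFlow σ Ψ)
    (hL : LipschitzWith K σ) (hσ : ContDiff ℝ ((⊤ : ℕ∞) : WithTop ℕ∞) σ) {x₀ : ℝ}
    {w x : ℝ≥0 → ℝ} (hx : IsRoughSolution σ x₀ w x) (hw : w 0 = 0) (T : ℝ≥0) :
    x T = Ψ (w T) x₀ := by
  obtain ⟨hx0, α, N, hα, hN, hT⟩ := hx
  obtain ⟨⟨A, hA⟩, θ, C, hθ, hC⟩ := hT T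
  -- Bounds for the two paths on `[0, T]`.
  obtain ⟨R, hR⟩ : ∃ R : ℝ, ∀ t ≤ T, |w t| ≤ R := by
    refine ⟨|A| * (T : ℝ) ^ α, fun t ht => ?_⟩
    have := hA 0 t (zero_le) ht
    simp only [hw, sub_zero, NNReal.coe_zero] at this
    refine this.trans (mul_le_mul (le_abs_self A) ?_ (by positivity) (abs_nonneg _))
    exact Real.rpow_le_rpow t.2 (by exact_mod_cast ht) hα.le
  have hR0 : 0 ≤ R := (abs_nonneg _).trans (hR 0 zero_le)
  obtain ⟨S, hS⟩ : ∃ S : ℝ, ∀ t ≤ T, |x t| ≤ S := by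
    refine ⟨|C| * (T : ℝ) ^ θ + ∑ k ∈ Finset.range (N + 1),
      |iterVectorField σ k x₀| * R ^ k / (k.factorial : ℝ), fun t ht => ?_⟩
    have h1 := hC 0 t zero_le ht
    simp only [hw, hx0, sub_zero, NNReal.coe_zero] at h1
    have h2 : C * (t : ℝ) ^ θ ≤ |C| * (T : ℝ) ^ θ :=
      mul_le_mul (le_abs_self C) (Real.rpow_le_rpow t.2 (by exact_mod_cast ht) (by linarith))
        (by positivity) (abs_nonneg _)
    have h3 : |∑ k ∈ Finset.range (N + 1), iterVectorField σ k x₀ * w t ^ k / (k.factorial : ℝ)| ≤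
        ∑ k ∈ Finset.range (N + 1), |iterVectorField σ k x₀| * R ^ k / (k.factorial : ℝ) := by
      refine (Finset.abs_sum_le_sum_abs _ _).trans (Finset.sum_le_sum fun k _ => ?_)
      rw [abs_div, abs_mul, abs_pow, Nat.abs_cast]
      gcongr
      exact hR t ht
    have h4 := abs_sub_abs_le_abs_sub (x t)
      (∑ k ∈ Finset.range (N + 1), iterVectorField σ k x₀ * w t ^ k / (k.factorial : ℝ))
    linarith
  obtain ⟨M, hM⟩ : ∃ M : ℝ, ∀ u y : ℝ, |u| ≤ 2 * R → |y| ≤ S →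
      |iterVectorField σ (N + 1) (Ψ u y)| ≤ M := by
    obtain ⟨Q, hQ⟩ := (isCompact_Icc (a := -(2 * R)) (b := 2 * R)).exists_bound_of_continuousOn
      (h.continuous 0).continuousOn
    obtain ⟨M, hM⟩ := (isCompact_Icc (a := -(Q + S * Real.exp (K * (2 * R))))
      (b := Q + S * Real.exp (K * (2 * R)))).exists_bound_of_continuousOn
      (contDiff_iterVectorField hσ (N + 1)).continuous.continuousOn
    refine ⟨M, fun u y hu hy => hM _ (abs_le.1 ?_)⟩
    have h1 : |Ψ u 0| ≤ Q := hQ u (abs_le.1 hu)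
    have h2 := h.abs_sub_le hL u y 0
    have h3 : |y - 0| * Real.exp (K * |u|) ≤ S * Real.exp (K * (2 * R)) := by
      rw [sub_zero]; gcongr
      exact (abs_nonneg _).trans hy
    have h4 := abs_sub_abs_le_abs_sub (Ψ u y) (Ψ u 0)
    linarith
  have hM0 : 0 ≤ M := (abs_nonneg _).trans (hM 0 (x 0) (by simpa using hR0) (hS 0 zero_le))
  set E := Real.exp (K * R) with hE
  have hconst := eq_of_abs_sub_le_rpow (h := fun t => Ψ (-(w t)) (x t)) (T := T)
    (C := |C| * E) (D := M * |A| ^ (N + 1) * E) hθ hN (fun s t hst htT => by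
      have hts : (0 : ℝ) ≤ (t : ℝ) - s := sub_nonneg.2 (by exact_mod_cast hst)
      have hback : Ψ (-(w s)) (x s) = Ψ (-(w t)) (Ψ (w t - w s) (x s)) := by
        rw [← h.add hL]; congr 1; ring
      have h1 := hC s t hst htT
      have hws : |w t - w s| ≤ 2 * R := by
        have := abs_sub (w t) (w s)
        linarith [hR t htT, hR s (hst.trans htT)]
      have h2 := abs_sub_taylor_le (n := N) (F := fun k u => iterVectorField σ k (Ψ u (x s)))
        (a := 0) (b := w t - w s) (M := M)
        (fun k _ u _ => h.hasDerivAt_iterVectorField hσ k u (x s))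
        (fun u hu => hM u _ (by
          have := Set.abs_sub_left_of_mem_uIcc hu
          simp only [sub_zero] at this
          exact this.trans hws) (hS s (hst.trans htT)))
      simp only [h.zero, sub_zero] at h2
      have hV0 : iterVectorField σ 0 (Ψ (w t - w s) (x s)) = Ψ (w t - w s) (x s) := rfl
      rw [hV0] at h2
      have h3 : |w t - w s| ^ (N + 1) ≤ |A| ^ (N + 1) * ((t : ℝ) - s) ^ (((N : ℝ) + 1) * α) := by
        have h4 : |w t - w s| ≤ |A| * ((t : ℝ) - s) ^ α :=
          (hA s t hst htT).trans (mul_le_mul_of_nonneg_right (le_abs_self A) (by positivity))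
        have h5 : (((t : ℝ) - s) ^ α) ^ (N + 1) = ((t : ℝ) - s) ^ (((N : ℝ) + 1) * α) := by
          rw [← Real.rpow_natCast, ← Real.rpow_mul hts]; push_cast; ring_nf
        calc |w t - w s| ^ (N + 1) ≤ (|A| * ((t : ℝ) - s) ^ α) ^ (N + 1) := by gcongr
          _ = _ := by rw [mul_pow, h5]
      have h6 : |x t - Ψ (w t - w s) (x s)| ≤ |C| * ((t : ℝ) - s) ^ θ +
          M * |A| ^ (N + 1) * ((t : ℝ) - s) ^ (((N : ℝ) + 1) * α) := by
        have h7 := abs_sub_le (x t) (∑ k ∈ Finset.range (N + 1),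
            iterVectorField σ k (x s) * (w t - w s) ^ k / (k.factorial : ℝ)) (Ψ (w t - w s) (x s))
        rw [abs_sub_comm (Ψ (w t - w s) (x s))] at h2
        have h8 : C * ((t : ℝ) - s) ^ θ ≤ |C| * ((t : ℝ) - s) ^ θ :=
          mul_le_mul_of_nonneg_right (le_abs_self C) (by positivity)
        have h9 := mul_le_mul_of_nonneg_left h3 hM0
        linarith
      have h10 := h.abs_sub_le hL (-(w t)) (x t) (Ψ (w t - w s) (x s))
      have h11 : Real.exp (K * |-(w t)|) ≤ E := by
        rw [abs_neg, hE]; gcongr; exact hR t htT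
      rw [hback]
      calc _ ≤ _ := h10
        _ ≤ (|C| * ((t : ℝ) - s) ^ θ +
          M * |A| ^ (N + 1) * ((t : ℝ) - s) ^ (((N : ℝ) + 1) * α)) * E :=
          mul_le_mul h6 h11 (Real.exp_pos _).le ((abs_nonneg _).trans h6)
        _ = _ := by ring)
  simp only [hw, hx0, neg_zero, h.zero] at hconst
  rw [← hconst, ← h.add hL, add_neg_cancel, h.zero]

/-! ### Exactness of the Newton–Cotes rules and integrals along a path -/

/-- The closed Newton–Cotes rule with `n + 1` nodes is exact on polynomials of degree at most `n`,
since these are their own Lagrange interpolants. -/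
theorem newtonCotes_exact_of_degree_lt {n : ℕ} (hn : n ≠ 0) {p : Polynomial ℝ}
    (hp : p.degree < (n + 1 : ℕ)) :
    ∑ j ∈ Finset.range (n + 1), newtonCotesWeight n j * p.eval ((j : ℝ) / n) =
      ∫ u in (0 : ℝ)..1, p.eval u := by
  have hn' : (n : ℝ) ≠ 0 := Nat.cast_ne_zero.2 hn
  set q : Polynomial ℝ := p.comp (Polynomial.C ((n : ℝ)⁻¹) * Polynomial.X) with hq
  have hqe : ∀ u, q.eval u = p.eval (u / n) := by
    intro u
    simp only [hq, Polynomial.eval_comp, Polynomial.eval_mul, Polynomial.eval_C, Polynomial.eval_X]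
    congr 1; field_simp
  have hqd : q.degree < ((Finset.range (n + 1)).card : ℕ) := by
    rw [Finset.card_range]
    rw [Polynomial.degree_lt_iff_coeff_zero] at hp ⊢
    intro k hk
    rw [hq, Polynomial.comp_C_mul_X_coeff, hp k hk, zero_mul]
  have hint := Lagrange.eq_interpolate (s := Finset.range (n + 1)) (v := fun j : ℕ => (j : ℝ))
    (Nat.cast_injective.injOn) hqd
  have hpu : ∀ u : ℝ, p.eval u = ∑ j ∈ Finset.range (n + 1), p.eval ((j : ℝ) / n) *
      ∏ k ∈ (Finset.range (n + 1)).erase j, ((n : ℝ) * u - k) / ((j : ℝ) - k) := by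
    intro u
    have h1 : p.eval u = q.eval (n * u) := by rw [hqe]; congr 1; field_simp
    rw [h1, hint, Lagrange.interpolate_apply, Polynomial.eval_finsetSum]
    refine Finset.sum_congr rfl fun j _ => ?_
    rw [Polynomial.eval_mul, Polynomial.eval_C, hqe, Lagrange.basis, Polynomial.eval_prod]
    congr 1
    refine Finset.prod_congr rfl fun k _ => ?_
    simp [Lagrange.basisDivisor, div_eq_inv_mul]
  rw [intervalIntegral.integral_congr fun u _ => hpu u, intervalIntegral.integral_finsetSum]
  · refine Finset.sum_congr rfl fun j _ => ?_
    rw [intervalIntegral.integral_const_mul, mul_comm, newtonCotesWeight]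
  · intro j _
    apply Continuous.intervalIntegrable
    fun_prop

theorem newtonCotesWeight_symm {n j : ℕ} (hj : j ≤ n) :
    newtonCotesWeight n (n - j) = newtonCotesWeight n j := by
  unfold newtonCotesWeight
  rw [← sub_zero (1 : ℝ), ← sub_self (1 : ℝ), ← intervalIntegral.integral_comp_sub_left,
    sub_self, sub_zero]
  refine intervalIntegral.integral_congr fun u _ => ?_
  refine Finset.prod_nbij' (fun k => n - k) (fun k => n - k) ?_ ?_ ?_ ?_ ?_
  · intro k hk; simp only [Finset.mem_erase, Finset.mem_range] at hk ⊢; omega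
  · intro k hk; simp only [Finset.mem_erase, Finset.mem_range] at hk ⊢; omega
  · intro k hk; simp only [Finset.mem_erase, Finset.mem_range] at hk; omega
  · intro k hk; simp only [Finset.mem_erase, Finset.mem_range] at hk; omega
  · intro k hk
    simp only [Finset.mem_erase, Finset.mem_range] at hk
    rw [Nat.cast_sub hj, Nat.cast_sub (by omega : k ≤ n), ← neg_div_neg_eq]
    congr 1 <;> ring

/-- The Newton–Cotes rule of order `m` is exact on monomials of degree below `2 m`. For `m ≥ 2` the
number of subintervals is even, and the symmetry of the weights gains one degree. -/
theorem newtonCotes_exact_pow {m k : ℕ} (hm : 1 ≤ m) (hk : k < 2 * m) :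
    ∑ j ∈ Finset.range (newtonCotesSub m + 1), newtonCotesWeight (newtonCotesSub m) j *
      ((j : ℝ) / newtonCotesSub m) ^ k = 1 / (k + 1) := by
  have hint : ∫ u in (0 : ℝ)..1, u ^ k = 1 / (k + 1) := by rw [integral_pow]; simp
  have hsub : newtonCotesSub m ≠ 0 := by unfold newtonCotesSub; split_ifs <;> omega
  rw [← hint]
  rcases lt_or_ge k (newtonCotesSub m + 1) with hlt | hge
  · have := newtonCotes_exact_of_degree_lt hsub (p := Polynomial.X ^ k)
      (by rw [Polynomial.degree_X_pow]; exact_mod_cast hlt)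
    simpa using this
  · have hkn : k = newtonCotesSub m + 1 ∧ Even (newtonCotesSub m) := by
      unfold newtonCotesSub at *
      split_ifs at * with h
      · omega
      · exact ⟨by omega, ⟨m - 1, by omega⟩⟩
    obtain ⟨hk', heven⟩ := hkn
    set n := newtonCotesSub m with hn
    have hn' : (n : ℝ) ≠ 0 := Nat.cast_ne_zero.2 hsub
    have hodd : Odd k := by rw [hk']; exact heven.add_one
    -- `u ^ k` and `(1 - u) ^ k` have the same integral and the same quadrature sum, and their
    -- sum `u ^ k - (u - 1) ^ k` has degree at most `n`.
    have hdeg : (Polynomial.X ^ k - (Polynomial.X - Polynomial.C 1) ^ k : Polynomial ℝ).degree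
        < (n + 1 : ℕ) := by
      have h1 : (Polynomial.X ^ k : Polynomial ℝ).degree = k := Polynomial.degree_X_pow k
      have h2 : ((Polynomial.X - Polynomial.C 1) ^ k : Polynomial ℝ).degree = k := by
        rw [Polynomial.degree_pow, Polynomial.degree_X_sub_C]; simp
      have h3 := Polynomial.degree_sub_lt_left (h1.trans h2.symm)
        (pow_ne_zero _ Polynomial.X_ne_zero)
        (by rw [(Polynomial.monic_X_pow k).leadingCoeff,
          ((Polynomial.monic_X_sub_C (1 : ℝ)).pow k).leadingCoeff])
      rw [h1, hk'] at h3
      rw [hk']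
      exact h3
    have h := newtonCotes_exact_of_degree_lt hsub hdeg
    simp only [Polynomial.eval_sub, Polynomial.eval_pow, Polynomial.eval_X,
      Polynomial.eval_C] at h
    have hneg : ∀ u : ℝ, (u - 1) ^ k = -(1 - u) ^ k := fun u => by
      rw [← hodd.neg_pow]; ring
    simp only [hneg, sub_neg_eq_add, mul_add, Finset.sum_add_distrib] at h
    rw [intervalIntegral.integral_add (by apply Continuous.intervalIntegrable; fun_prop)
      (by apply Continuous.intervalIntegrable; fun_prop),
      intervalIntegral.integral_comp_sub_left (fun u => u ^ k) 1, sub_self, sub_zero] at h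
    have hrefl : ∑ j ∈ Finset.range (n + 1), newtonCotesWeight n j * (1 - (j : ℝ) / n) ^ k =
        ∑ j ∈ Finset.range (n + 1), newtonCotesWeight n j * ((j : ℝ) / n) ^ k := by
      rw [← Finset.sum_range_reflect]
      refine Finset.sum_congr rfl fun j hj => ?_
      have hj' : j ≤ n := Nat.lt_succ_iff.1 (Finset.mem_range.1 hj)
      rw [show n + 1 - 1 - j = n - j by omega, newtonCotesWeight_symm hj', Nat.cast_sub hj']
      congr 2; field_simp; ring
    rw [hrefl] at h
    linarith

/-- On bounded sets the Newton–Cotes rule of order `m` for the increment of a primitive `F` has an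
error of order `2 m + 1`. -/
theorem exists_newtonCotes_error_le {m : ℕ} (hm : 1 ≤ m) {F : ℝ → ℝ}
    (hF : ContDiff ℝ ((2 * m + 1 : ℕ) : WithTop ℕ∞) F) (R : ℝ) :
    ∃ C : ℝ, ∀ a b : ℝ, |a| ≤ R → |b| ≤ R →
      |(b - a) * ∑ j ∈ Finset.range (newtonCotesSub m + 1), newtonCotesWeight (newtonCotesSub m) j *
        deriv F (a + (j : ℝ) / newtonCotesSub m * (b - a)) - (F b - F a)| ≤
      C * |b - a| ^ (2 * m + 1) := by
  set n := newtonCotesSub m with hn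
  have hsub : n ≠ 0 := by rw [hn]; unfold newtonCotesSub; split_ifs <;> omega
  have hn' : (0 : ℝ) < n := Nat.cast_pos.2 (Nat.pos_of_ne_zero hsub)
  obtain ⟨M, hM⟩ := (isCompact_Icc (a := -R) (b := R)).exists_bound_of_continuousOn
    (hF.continuous_iteratedDeriv (2 * m + 1) le_rfl).continuousOn
  have hd : ∀ k ≤ 2 * m, ∀ u, HasDerivAt (iteratedDeriv k F) (iteratedDeriv (k + 1) F u) u := by
    intro k hk u
    rw [iteratedDeriv_succ]
    exact (hF.differentiable_iteratedDeriv k (by exact_mod_cast Nat.lt_succ_of_le hk) u).hasDerivAt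
  refine ⟨(∑ j ∈ Finset.range (n + 1), |newtonCotesWeight n j|) * M + M, fun a b ha hb => ?_⟩
  have hsubset : Set.uIcc a b ⊆ Set.Icc (-R) R := by
    exact Set.uIcc_subset_Icc (abs_le.1 ha) (abs_le.1 hb)
  have h1 := abs_sub_taylor_le (n := 2 * m) (F := fun k => iteratedDeriv k F) (a := a) (b := b)
    (M := M) (fun k hk u _ => hd k hk u) (fun u hu => hM u (hsubset hu))
  rw [Finset.sum_range_succ'] at h1
  simp only [iteratedDeriv_zero, pow_zero, mul_one, Nat.factorial_zero, Nat.cast_one,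
    div_one] at h1
  have h2 : ∀ j ∈ Finset.range (n + 1), |deriv F (a + (j : ℝ) / n * (b - a)) -
      ∑ k ∈ Finset.range (2 * m), iteratedDeriv (k + 1) F a * ((j : ℝ) / n * (b - a)) ^ k /
        (k.factorial : ℝ)| ≤ M * |b - a| ^ (2 * m) := by
    intro j hj
    have hj1 : (j : ℝ) / n ≤ 1 := by
      rw [div_le_one hn']
      exact_mod_cast Nat.lt_succ_iff.1 (Finset.mem_range.1 hj)
    have hj0 : (0 : ℝ) ≤ (j : ℝ) / n := by positivity
    have hmem : a + (j : ℝ) / n * (b - a) ∈ Set.uIcc a b := by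
      rw [Set.mem_uIcc]
      rcases le_total a b with h | h
      · left; constructor <;> nlinarith
      · right; constructor <;> nlinarith
    have hss := Set.uIcc_subset_uIcc_left hmem
    have h3 := abs_sub_taylor_le (n := 2 * m - 1) (F := fun k => iteratedDeriv (k + 1) F) (a := a)
      (b := a + (j : ℝ) / n * (b - a)) (M := M)
      (fun k hk u _ => hd (k + 1) (by omega) u) (fun u hu => by
        rw [show 2 * m - 1 + 1 + 1 = 2 * m + 1 by omega]
        exact hM u (hsubset (hss hu)))
    rw [show 2 * m - 1 + 1 = 2 * m by omega] at h3
    simp only [add_sub_cancel_left, zero_add, iteratedDeriv_one] at h3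
    refine h3.trans ?_
    have hM0 : 0 ≤ M := (abs_nonneg _).trans (hM a (abs_le.1 ha))
    gcongr M * ?_ ^ _
    rw [abs_mul, abs_of_nonneg hj0]
    exact mul_le_of_le_one_left (abs_nonneg _) hj1
  set r : ℕ → ℝ := fun j => deriv F (a + (j : ℝ) / n * (b - a)) -
      ∑ k ∈ Finset.range (2 * m), iteratedDeriv (k + 1) F a * ((j : ℝ) / n * (b - a)) ^ k /
        (k.factorial : ℝ) with hr
  -- By exactness the quadrature of the Taylor polynomial of `F'` is the Taylor polynomial of `F`.
  have hexact : (b - a) * ∑ j ∈ Finset.range (n + 1), newtonCotesWeight n j *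
      ∑ k ∈ Finset.range (2 * m), iteratedDeriv (k + 1) F a * ((j : ℝ) / n * (b - a)) ^ k /
        (k.factorial : ℝ) =
      ∑ k ∈ Finset.range (2 * m), iteratedDeriv (k + 1) F a * (b - a) ^ (k + 1) /
        ((k + 1).factorial : ℝ) := by
    simp_rw [Finset.mul_sum]
    rw [Finset.sum_comm]
    refine Finset.sum_congr rfl fun k hk => ?_
    have h4 := newtonCotes_exact_pow hm (Finset.mem_range.1 hk)
    rw [← hn] at h4
    have h5 : ((k : ℝ) + 1) ≠ 0 := by positivity
    have h6 : (k.factorial : ℝ) ≠ 0 := by positivity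
    calc _ = iteratedDeriv (k + 1) F a * (b - a) ^ (k + 1) / (k.factorial : ℝ) *
          ∑ j ∈ Finset.range (n + 1), newtonCotesWeight n j * ((j : ℝ) / n) ^ k := by
          rw [Finset.mul_sum]
          refine Finset.sum_congr rfl fun j _ => ?_
          rw [mul_pow, pow_succ]; ring
      _ = _ := by
          rw [h4, Nat.factorial_succ]; push_cast; field_simp
  have hsplit : (b - a) * ∑ j ∈ Finset.range (n + 1), newtonCotesWeight n j *
        deriv F (a + (j : ℝ) / n * (b - a)) = (b - a) * ∑ j ∈ Finset.range (n + 1),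
        newtonCotesWeight n j * r j + ∑ k ∈ Finset.range (2 * m), iteratedDeriv (k + 1) F a *
        (b - a) ^ (k + 1) / ((k + 1).factorial : ℝ) := by
    rw [← hexact, ← mul_add, ← Finset.sum_add_distrib]
    congr 1
    refine Finset.sum_congr rfl fun j _ => ?_
    simp only [hr]; ring
  have hr' : |(b - a) * ∑ j ∈ Finset.range (n + 1), newtonCotesWeight n j * r j| ≤
      (∑ j ∈ Finset.range (n + 1), |newtonCotesWeight n j|) * M * |b - a| ^ (2 * m + 1) := by
    rw [abs_mul, pow_succ]
    have h7 : |∑ j ∈ Finset.range (n + 1), newtonCotesWeight n j * r j| ≤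
        (∑ j ∈ Finset.range (n + 1), |newtonCotesWeight n j|) * (M * |b - a| ^ (2 * m)) := by
      rw [Finset.sum_mul]
      refine (Finset.abs_sum_le_sum_abs _ _).trans (Finset.sum_le_sum fun j hj => ?_)
      rw [abs_mul]
      exact mul_le_mul_of_nonneg_left (h2 j hj) (abs_nonneg _)
    calc _ ≤ |b - a| * ((∑ j ∈ Finset.range (n + 1), |newtonCotesWeight n j|) *
          (M * |b - a| ^ (2 * m))) := by gcongr
      _ = _ := by ring
  rw [hsplit, add_mul]
  rw [abs_le] at *
  constructor <;> linarith [hr'.1, hr'.2, h1.1, h1.2]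

/-- For a continuous `φ` the averaged difference quotient `ε⁻¹ ∫₀ᵗ (φ (s + ε) - φ s) ds` tends to
the increment of `φ`. -/
theorem tendsto_average_increment {φ : ℝ → ℝ} (hφ : Continuous φ) (t : ℝ) :
    Tendsto (fun ε : ℝ => ε⁻¹ * ∫ s in (0 : ℝ)..t, (φ (s + ε) - φ s)) (𝓝[>] 0)
      (𝓝 (φ t - φ 0)) := by
  have hd : ∀ x, HasDerivAt (fun x => ∫ s in (0 : ℝ)..x, φ s) (φ x) x := fun x =>
    (hφ.integral_hasStrictDerivAt 0 x).hasDerivAt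
  have hi : ∀ a b, IntervalIntegrable φ volume a b := fun a b => hφ.intervalIntegrable a b
  have h1 := ((hasDerivAt_iff_tendsto_slope_zero.1 (hd t)).sub
    (hasDerivAt_iff_tendsto_slope_zero.1 (hd 0))).mono_left
    (nhdsWithin_mono 0 (fun x (hx : 0 < x) => hx.ne'))
  refine h1.congr fun ε => ?_
  rw [intervalIntegral.integral_sub ((by fun_prop : Continuous _).intervalIntegrable _ _) (hi _ _),
    intervalIntegral.integral_comp_add_right]
  simp only [zero_add, intervalIntegral.integral_same, sub_zero, smul_eq_mul]
  rw [← mul_sub]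
  congr 1
  have h2 := intervalIntegral.integral_add_adjacent_intervals (hi 0 ε) (hi ε (t + ε))
  linarith

/-- Pathwise, the Newton–Cotes integral of `F'` along `w` is `F (w t) - F (w 0)` along any sequence
of `ε` for which the mean `(2 m + 1)`-th variation of `w` vanishes. -/
theorem tendsto_newtonCotesApprox {m : ℕ} (hm : 1 ≤ m) {F : ℝ → ℝ}
    (hF : ContDiff ℝ ((2 * m + 1 : ℕ) : WithTop ℕ∞) F) {w : ℝ≥0 → ℝ} (hw : Continuous w) (t : ℝ≥0)
    {e : ℕ → ℝ} (he : Tendsto e atTop (𝓝[>] 0))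
    (hvar : Tendsto (fun n => (e n)⁻¹ * ∫ s in (0 : ℝ)..t,
      |w (s + e n).toNNReal - w s.toNNReal| ^ (2 * m + 1)) atTop (𝓝 0)) :
    Tendsto (fun n => newtonCotesApprox m (deriv F) w t (e n)) atTop
      (𝓝 (F (w t) - F (w 0))) := by
  have hw' : Continuous fun s : ℝ => w s.toNNReal := hw.comp continuous_real_toNNReal
  have hF0 : Continuous F := hF.continuous
  have hF1 : Continuous (deriv F) := hF.continuous_deriv (by
    exact_mod_cast (by omega : 1 ≤ 2 * m + 1))
  obtain ⟨R, hR⟩ := (isCompact_Icc (a := (0 : ℝ)) (b := t + 1)).exists_bound_of_continuousOn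
    hw'.continuousOn
  obtain ⟨C, hC⟩ := exists_newtonCotes_error_le hm hF R
  have h1 := (tendsto_average_increment (φ := fun s => F (w s.toNNReal)) (hF0.comp hw') t).comp he
  simp only [Real.toNNReal_coe, Real.toNNReal_zero] at h1
  have h2 : Tendsto (fun n => newtonCotesApprox m (deriv F) w t (e n) -
      (e n)⁻¹ * ∫ s in (0 : ℝ)..t, (F (w (s + e n).toNNReal) - F (w s.toNNReal))) atTop (𝓝 0) := by
    have hvar' := hvar.const_mul C
    rw [mul_zero] at hvar'
    refine squeeze_zero_norm' ?_ hvar'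
    have he1 : ∀ᶠ n in atTop, e n ∈ Set.Ioc (0 : ℝ) 1 :=
      he.eventually (Ioc_mem_nhdsGT one_pos)
    filter_upwards [he1] with n hn
    have hw'' : Continuous fun s : ℝ => w (s + e n).toNNReal := by fun_prop
    have hint1 : Continuous fun s : ℝ => (w (s + e n).toNNReal - w s.toNNReal) *
      ∑ j ∈ Finset.range (newtonCotesSub m + 1), newtonCotesWeight (newtonCotesSub m) j *
        deriv F (w s.toNNReal + (j : ℝ) / (newtonCotesSub m : ℝ) *
          (w (s + e n).toNNReal - w s.toNNReal)) := by fun_prop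
    have hint2 : Continuous fun s : ℝ => F (w (s + e n).toNNReal) - F (w s.toNNReal) := by fun_prop
    have hint3 : Continuous fun s : ℝ =>
      |w (s + e n).toNNReal - w s.toNNReal| ^ (2 * m + 1) := by fun_prop
    rw [newtonCotesApprox, ← mul_sub, ← intervalIntegral.integral_sub
      (hint1.intervalIntegrable _ _) (hint2.intervalIntegrable _ _), norm_mul, norm_inv,
      Real.norm_of_nonneg hn.1.le, mul_left_comm, ← intervalIntegral.integral_const_mul]
    refine mul_le_mul_of_nonneg_left ?_ (inv_nonneg.2 hn.1.le)
    refine intervalIntegral.norm_integral_le_of_norm_le t.2 (Eventually.of_forall fun s hs => ?_)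
      ((continuous_const.mul hint3).intervalIntegrable _ _)
    exact hC _ _ (hR s ⟨hs.1.le, hs.2.trans (by simp)⟩)
      (hR (s + e n) ⟨by linarith [hs.1, hn.1], add_le_add hs.2 hn.2⟩)
  simpa using h2.add h1

/-! ### Fractional Brownian motion and its pathwise equations -/

namespace IsFractionalBrownianMotion

variable {Ω : Type*} [MeasurableSpace Ω] {P : Measure Ω} {H : ℝ} {B : ℝ≥0 → Ω → ℝ}

theorem integral_sub_sq [IsProbabilityMeasure P] (hB : IsFractionalBrownianMotion P H B)
    (hH : H ≠ 0) (s t : ℝ≥0) :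
    ∫ ω, (B t ω - B s ω) ^ 2 ∂P = |(t : ℝ) - s| ^ (2 * H) := by
  have hm : ∀ u, MemLp (B u) 2 P := fun u => (hB.isGaussianProcess.hasGaussianLaw_eval u).memLp_two
  have hi : ∀ u v, Integrable (fun ω => B u ω * B v ω) P := fun u v => (hm u).integrable_mul (hm v)
  have h1 : ∀ ω, (B t ω - B s ω) ^ 2 = B t ω * B t ω - 2 * (B s ω * B t ω) + B s ω * B s ω :=
    fun ω => by ring
  have h2 : ∀ u : ℝ≥0, ∫ ω, B u ω * B u ω ∂P = (u : ℝ) ^ (2 * H) := fun u => by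
    rw [hB.covariance u u, sub_self, abs_zero, Real.zero_rpow (by simpa using hH)]; ring
  simp_rw [h1]
  have hi' : Integrable (fun ω => B t ω * B t ω - 2 * (B s ω * B t ω)) P :=
    (hi t t).sub ((hi s t).const_mul 2)
  rw [integral_add hi' (hi s s), integral_sub (hi t t) ((hi s t).const_mul 2),
    integral_const_mul, h2, h2, hB.covariance s t]
  ring

theorem map_sub_eq [IsProbabilityMeasure P] (hB : IsFractionalBrownianMotion P H B)
    (hH : H ≠ 0) (s t : ℝ≥0) :
    P.map (fun ω => B t ω - B s ω) = gaussianReal 0 (|(t : ℝ) - s| ^ (2 * H)).toNNReal := by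
  have hg : HasGaussianLaw (fun ω => B t ω - B s ω) P := hB.isGaussianProcess.hasGaussianLaw_fun_sub
  have hi : ∀ u, Integrable (B u) P := fun u =>
    (hB.isGaussianProcess.hasGaussianLaw_eval u).integrable
  have h0 : ∫ ω, (B t ω - B s ω) ∂P = 0 := by
    rw [integral_sub (hi t) (hi s), hB.centered, hB.centered, sub_zero]
  rw [hg.map_eq_gaussianReal, h0, variance_of_integral_eq_zero hg.aemeasurable h0,
    hB.integral_sub_sq hH]

theorem ae_zero [IsProbabilityMeasure P] (hB : IsFractionalBrownianMotion P H B) (hH : H ≠ 0) :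
    ∀ᵐ ω ∂P, B 0 ω = 0 := by
  have h1 : ∫ ω, B 0 ω * B 0 ω ∂P = 0 := by
    rw [hB.covariance 0 0, NNReal.coe_zero, sub_self, abs_zero,
      Real.zero_rpow (by simpa using hH)]
    ring
  have hm : MemLp (B 0) 2 P := (hB.isGaussianProcess.hasGaussianLaw_eval 0).memLp_two
  have h2 := (integral_eq_zero_iff_of_nonneg (fun ω => mul_self_nonneg (B 0 ω))
    (hm.integrable_mul hm)).1 h1
  filter_upwards [h2] with ω hω
  exact mul_self_eq_zero.1 hω

theorem map_eq [IsProbabilityMeasure P] (hB : IsFractionalBrownianMotion P H B)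
    (hH : H ≠ 0) (t : ℝ≥0) :
    P.map (B t) = gaussianReal 0 ((t : ℝ) ^ (2 * H)).toNNReal := by
  have h1 := hB.map_sub_eq hH 0 t
  rw [NNReal.coe_zero, sub_zero, abs_of_nonneg t.coe_nonneg] at h1
  rw [← h1]
  refine Measure.map_congr ?_
  filter_upwards [hB.ae_zero hH] with ω hω
  rw [hω, sub_zero]

/-- A version all of whose coordinates are measurable and all of whose paths are continuous; it is
jointly measurable, as Tonelli's theorem requires. -/
theorem exists_continuous_version (hB : IsFractionalBrownianMotion P H B) :
    ∃ B' : ℝ≥0 → Ω → ℝ, (∀ t, Measurable (B' t)) ∧ (∀ ω, Continuous fun t => B' t ω) ∧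
      ∀ᵐ ω ∂P, ∀ t, B' t ω = B t ω := by
  obtain ⟨D, hDc, hDd⟩ := TopologicalSpace.exists_countable_dense ℝ≥0
  have hae : ∀ t, AEMeasurable (B t) P := hB.isGaussianProcess.aemeasurable
  have hgood : ∀ᵐ ω ∂P, (∀ q ∈ D, B q ω = (hae q).mk (B q) ω) ∧ Continuous fun t => B t ω :=
    ((ae_ball_iff hDc).2 fun q _ => (hae q).ae_eq_mk).and hB.continuous_paths
  set N := toMeasurable P {ω | ¬((∀ q ∈ D, B q ω = (hae q).mk (B q) ω) ∧
    Continuous fun t => B t ω)} with hN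
  have hNm : MeasurableSet N := measurableSet_toMeasurable _ _
  have hNg : ∀ ω ∉ N, (∀ q ∈ D, B q ω = (hae q).mk (B q) ω) ∧ Continuous fun t => B t ω := by
    intro ω hω
    by_contra h
    exact hω (subset_toMeasurable _ _ h)
  have hN0 : P N = 0 := by rw [hN, measure_toMeasurable]; exact hgood
  refine ⟨fun t => Nᶜ.indicator (B t), fun t => ?_, fun ω => ?_, ?_⟩
  · have hq : ∀ q ∈ D, Measurable (Nᶜ.indicator (B q)) := by
      intro q hqD
      have : Nᶜ.indicator (B q) = Nᶜ.indicator ((hae q).mk (B q)) := by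
        refine Set.indicator_congr fun ω hω => (hNg ω hω).1 q hqD
      rw [this]
      exact (hae q).measurable_mk.indicator hNm.compl
    obtain ⟨u, huD, hut⟩ := mem_closure_iff_seq_limit.1 (hDd t)
    refine measurable_of_tendsto_metrizable (fun n => hq (u n) (huD n)) ?_
    rw [tendsto_pi_nhds]
    intro ω
    by_cases hω : ω ∈ N
    · simp [hω]
    · simpa [hω, Function.comp_def] using ((hNg ω hω).2.tendsto t).comp hut
  · by_cases hω : ω ∈ N
    · simpa [hω] using continuous_const
    · simpa [hω] using (hNg ω hω).2
  · filter_upwards [measure_eq_zero_iff_ae_notMem.1 hN0] with ω hω t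
    simp [hω]

end IsFractionalBrownianMotion

/-- Absolute moments of a centred Gaussian scale like powers of the standard deviation. -/
theorem lintegral_enorm_pow_gaussianReal (c : ℝ) (k : ℕ) :
    ∫⁻ x, ‖x‖ₑ ^ k ∂gaussianReal 0 (c ^ 2).toNNReal =
      ‖c‖ₑ ^ k * ∫⁻ x, ‖x‖ₑ ^ k ∂gaussianReal 0 1 := by
  have h := gaussianReal_map_const_mul (μ := 0) (v := 1) c
  have hv : (⟨c ^ 2, sq_nonneg c⟩ : ℝ≥0) * 1 = (c ^ 2).toNNReal := by
    rw [mul_one]; ext; simp [sq_nonneg]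
  rw [mul_zero] at h
  rw [← hv]
  refine (congrArg (fun μ => ∫⁻ x, ‖x‖ₑ ^ k ∂μ) h.symm).trans ?_
  rw [lintegral_map (by fun_prop) (by fun_prop), ← lintegral_const_mul _ (by fun_prop)]
  simp_rw [enorm_mul, mul_pow]

theorem lintegral_enorm_pow_gaussianReal_lt_top (k : ℕ) :
    ∫⁻ x, ‖x‖ₑ ^ k ∂gaussianReal 0 1 < ∞ := by
  rcases eq_or_ne k 0 with rfl | hk
  · simp
  · have h := memLp_id_gaussianReal (μ := 0) (v := 1) (k : ℝ≥0)
    have h2 := (eLpNorm_lt_top_iff_lintegral_rpow_enorm_lt_top (by simpa using hk)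
      (by simp)).1 h.2
    simpa using h2

/-- If `k H > 1`, the mean `k`-th variation of fractional Brownian motion vanishes: its expectation
is of order `ε ^ (k H - 1)`. -/
theorem tendstoInMeasure_variation {Ω : Type*} [MeasurableSpace Ω] {P : Measure Ω}
    [IsProbabilityMeasure P] {H : ℝ} {B : ℝ≥0 → Ω → ℝ} (hB : IsFractionalBrownianMotion P H B)
    (hH : 0 < H) (hBm : ∀ t, Measurable (B t)) (hBc : ∀ ω, Continuous fun t => B t ω)
    {k : ℕ} (hk : 1 < k * H) (t : ℝ≥0) {e : ℕ → ℝ} (he : Tendsto e atTop (𝓝[>] 0))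
    (hpos : ∀ n, 0 < e n) :
    TendstoInMeasure P (fun n ω => (e n)⁻¹ * ∫ s in (0 : ℝ)..t,
      |B (s + e n).toNNReal ω - B s.toNNReal ω| ^ k) atTop (fun _ => 0) := by
  have hjoint : Measurable (Function.uncurry B) := measurable_uncurry_of_continuous_of_measurable
    hBc hBm
  have hj : ∀ ε : ℝ, Measurable fun p : Ω × ℝ =>
      B (p.2 + ε).toNNReal p.1 - B p.2.toNNReal p.1 := fun ε => by
    have h1 : Measurable fun p : Ω × ℝ => ((p.2 + ε).toNNReal, p.1) := by fun_prop
    have h2 : Measurable fun p : Ω × ℝ => (p.2.toNNReal, p.1) := by fun_prop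
    exact (hjoint.comp h1).sub (hjoint.comp h2)
  set m := ∫⁻ x, ‖x‖ₑ ^ k ∂gaussianReal 0 1 with hm
  have hmt : m < ∞ := lintegral_enorm_pow_gaussianReal_lt_top k
  have hinc : ∀ ε : ℝ, 0 < ε → ∀ s : ℝ, 0 < s →
      ∫⁻ ω, ‖B (s + ε).toNNReal ω - B s.toNNReal ω‖ₑ ^ k ∂P = ENNReal.ofReal (ε ^ (k * H)) * m := by
    intro ε hε s hs
    have h1 := hB.map_sub_eq hH.ne' s.toNNReal (s + ε).toNNReal
    rw [Real.coe_toNNReal _ hs.le, Real.coe_toNNReal _ (by positivity), add_sub_cancel_left,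
      abs_of_pos hε, mul_comm 2 H, Real.rpow_mul hε.le] at h1
    have h2 : ∀ x : ℝ, x ^ (2 : ℝ) = x ^ 2 := fun x => by exact_mod_cast Real.rpow_natCast x 2
    rw [h2] at h1
    have h3 := lintegral_enorm_pow_gaussianReal (ε ^ H) k
    rw [← h1, lintegral_map (f := fun x : ℝ => ‖x‖ₑ ^ k) (by fun_prop)
      (g := fun ω => B (s + ε).toNNReal ω - B s.toNNReal ω) ((hBm _).sub (hBm _))] at h3
    rw [h3, Real.enorm_of_nonneg (by positivity), ← ENNReal.ofReal_pow (by positivity),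
      ← Real.rpow_natCast, ← Real.rpow_mul hε.le, mul_comm H]
  have hL1 : ∀ n, eLpNorm (fun ω => (e n)⁻¹ * ∫ s in (0 : ℝ)..t,
      |B (s + e n).toNNReal ω - B s.toNNReal ω| ^ k) 1 P ≤
      ENNReal.ofReal ((e n) ^ (k * H - 1)) * (m * t) := by
    intro n
    rw [eLpNorm_one_eq_lintegral_enorm]
    have h1 : ∀ ω, ‖(e n)⁻¹ * ∫ s in (0 : ℝ)..t,
        |B (s + e n).toNNReal ω - B s.toNNReal ω| ^ k‖ₑ ≤ ENNReal.ofReal (e n)⁻¹ *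
        ∫⁻ s in Set.Ioc (0 : ℝ) t, ‖B (s + e n).toNNReal ω - B s.toNNReal ω‖ₑ ^ k := by
      intro ω
      rw [enorm_mul, Real.enorm_of_nonneg (inv_nonneg.2 (hpos n).le),
        intervalIntegral.integral_of_le t.coe_nonneg]
      gcongr
      refine (enorm_integral_le_lintegral_enorm _).trans (lintegral_mono fun s => ?_)
      rw [enorm_pow, Real.enorm_abs]
    calc _ ≤ ∫⁻ ω, ENNReal.ofReal (e n)⁻¹ *
          (∫⁻ s in Set.Ioc (0 : ℝ) t, ‖B (s + e n).toNNReal ω - B s.toNNReal ω‖ₑ ^ k) ∂P :=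
          lintegral_mono h1
      _ = ENNReal.ofReal (e n)⁻¹ * ∫⁻ ω, (∫⁻ s in Set.Ioc (0 : ℝ) t,
          ‖B (s + e n).toNNReal ω - B s.toNNReal ω‖ₑ ^ k) ∂P := by
          rw [lintegral_const_mul]
          exact Measurable.lintegral_prod_right' ((hj (e n)).enorm.pow_const k)
      _ = ENNReal.ofReal (e n)⁻¹ * ∫⁻ s in Set.Ioc (0 : ℝ) t, ∫⁻ ω,
          ‖B (s + e n).toNNReal ω - B s.toNNReal ω‖ₑ ^ k ∂P := by
          rw [lintegral_lintegral_swap]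
          exact ((hj (e n)).enorm.pow_const k).aemeasurable
      _ = ENNReal.ofReal (e n)⁻¹ * ∫⁻ s in Set.Ioc (0 : ℝ) t,
          ENNReal.ofReal ((e n) ^ (k * H)) * m := by
          congr 1
          exact setLIntegral_congr_fun measurableSet_Ioc fun s hs => hinc _ (hpos n) s hs.1
      _ = ENNReal.ofReal ((e n) ^ (k * H - 1)) * (m * t) := by
          rw [setLIntegral_const, Real.volume_Ioc, sub_zero, ENNReal.ofReal_coe_nnreal,
            ← mul_assoc, ← mul_assoc, ← ENNReal.ofReal_mul (inv_nonneg.2 (hpos n).le),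
            Real.rpow_sub_one (hpos n).ne', mul_assoc, div_eq_inv_mul]
  refine tendstoInMeasure_of_tendsto_eLpNorm one_ne_zero (fun n => ?_)
    aestronglyMeasurable_const ?_
  · have h1 : StronglyMeasurable fun p : Ω × ℝ =>
        |B (p.2 + e n).toNNReal p.1 - B p.2.toNNReal p.1| ^ k :=
      ((measurable_norm.comp (hj (e n))).pow_const k).stronglyMeasurable
    simp_rw [intervalIntegral.integral_of_le t.coe_nonneg]
    exact (h1.integral_prod_right'.aestronglyMeasurable).const_mul _
  · have h2 : Tendsto (fun n => ENNReal.ofReal ((e n) ^ (k * H - 1)) * (m * t)) atTop (𝓝 0) := by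
      have h3 : Tendsto (fun n => (e n) ^ (k * H - 1)) atTop (𝓝 0) := by
        have h4 : Tendsto (fun x : ℝ => x ^ (k * H - 1)) (𝓝 0) (𝓝 0) := by
          have := (Real.continuousAt_rpow_const 0 (k * H - 1) (Or.inr (by linarith))).tendsto
          rwa [Real.zero_rpow (by linarith)] at this
        exact h4.comp (he.mono_right nhdsWithin_le_nhds)
      have h5 := ENNReal.Tendsto.mul_const (b := m * t) (ENNReal.tendsto_ofReal h3)
        (Or.inr (ENNReal.mul_ne_top hmt.ne ENNReal.coe_ne_top))
      simpa using h5
    refine tendsto_of_tendsto_of_tendsto_of_le_of_le tendsto_const_nhds h2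
      (fun _ => zero_le) fun n => ?_
    have := hL1 n
    simpa [Pi.sub_def] using this

/-- Continuous functions of a nondegenerate Gaussian variable that agree almost surely agree
everywhere. -/
theorem eq_of_ae_eq_comp_gaussian {Ω : Type*} [MeasurableSpace Ω] {P : Measure Ω} {Z : Ω → ℝ}
    {v : ℝ≥0} (hv : v ≠ 0) (hZ : AEMeasurable Z P) (hlaw : P.map Z = gaussianReal 0 v)
    {f g : ℝ → ℝ} (hf : Continuous f) (hg : Continuous g)
    (h : ∀ᵐ ω ∂P, f (Z ω) = g (Z ω)) : f = g := by
  have h1 : ∀ᵐ x ∂P.map Z, f x = g x :=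
    (ae_map_iff hZ (measurableSet_eq_fun hf.measurable hg.measurable)).2 h
  rw [hlaw] at h1
  exact (hf.ae_eq_iff_eq volume hg).1 ((gaussianReal_absolutelyContinuous' 0 hv).ae_le h1)

/-- A solution `f (B t)` in the Newton–Cotes sense is a flow line run along `B`: the Newton–Cotes
integral obeys the chain rule, so `f` solves the ordinary differential equation. -/
theorem IsNewtonCotesSolution.ae_eq_flow {Ω : Type*} [MeasurableSpace Ω] {P : Measure Ω}
    [IsProbabilityMeasure P] {H : ℝ} (hH : 0 < H) {B X : ℝ≥0 → Ω → ℝ}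
    (hB : IsFractionalBrownianMotion P H B) {σ : ℝ → ℝ} {Ψ : ℝ → ℝ → ℝ} {K : ℝ≥0}
    (h : IsFlow σ Ψ) (hL : LipschitzWith K σ)
    (hσ : ContDiff ℝ ((⊤ : ℕ∞) : WithTop ℕ∞) σ) {x₀ : ℝ} {m : ℕ} (hm : 1 ≤ m)
    (hmH : 1 < (2 * m + 1) * H) (hX : IsNewtonCotesSolution P m σ x₀ B X) (t : ℝ≥0) :
    ∀ᵐ ω ∂P, X t ω = Ψ (B t ω) x₀ := by
  obtain ⟨f, hf, hXf, hlim⟩ := hX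
  obtain ⟨B', hB'm, hB'c, hB'B⟩ := hB.exists_continuous_version
  have hB' : IsFractionalBrownianMotion P H B' := by
    have hae : ∀ s, B s =ᵐ[P] B' s := fun s => by
      filter_upwards [hB'B] with ω hω using (hω s).symm
    refine ⟨hB.isGaussianProcess.congr hae, fun s => ?_, fun s u => ?_,
      Eventually.of_forall hB'c⟩
    · rw [← hB.centered s]; exact integral_congr_ae (hae s).symm
    · rw [← hB.covariance s u]; exact integral_congr_ae ((hae s).mul (hae u)).symm
  set g : ℝ → ℝ := fun b => σ (f b) with hg
  set F : ℝ → ℝ := fun b => ∫ u in (0 : ℝ)..b, g u with hF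
  have hgs : ContDiff ℝ ((2 * m : ℕ) : WithTop ℕ∞) g :=
    (contDiff_infty.1 hσ (2 * m)).comp
      (hf.of_le (by exact_mod_cast (by omega : 2 * m ≤ 4 * m + 1)))
  have hFd : ∀ b, HasDerivAt F (g b) b := fun b =>
    (hgs.continuous.integral_hasStrictDerivAt 0 b).hasDerivAt
  have hF' : deriv F = g := funext fun b => (hFd b).deriv
  have hFs : ContDiff ℝ ((2 * m + 1 : ℕ) : WithTop ℕ∞) F := by
    rw [Nat.cast_succ, contDiff_succ_iff_deriv]
    refine ⟨fun b => (hFd b).differentiableAt, fun h => absurd h (WithTop.natCast_ne_top _), ?_⟩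
    rwa [hF']
  -- The Newton–Cotes integral of `σ ∘ f` along `B` is the increment of the primitive `F`.
  have hsol : ∀ᵐ ω ∂P, x₀ + F (B' 1 ω) = f (B' 1 ω) := by
    obtain ⟨e₀, he₀, hlim₀⟩ := (hlim 1).exists_seq_tendsto_ae'
    obtain ⟨N, hN⟩ := eventually_atTop.1
      (he₀.eventually (self_mem_nhdsWithin : Set.Ioi (0 : ℝ) ∈ 𝓝[>] 0))
    set e : ℕ → ℝ := fun n => e₀ (n + N) with he
    have het : Tendsto e atTop (𝓝[>] 0) := he₀.comp (tendsto_add_atTop_nat N)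
    obtain ⟨ns, hns, hvar⟩ := (tendstoInMeasure_variation hB' hH hB'm hB'c (k := 2 * m + 1)
      (by push_cast; exact hmH) 1 het (fun n => hN _ (by omega))).exists_seq_tendsto_ae
    filter_upwards [hlim₀, hvar, hB'B, hXf 1, hB'.ae_zero hH.ne'] with ω h1 h2 h3 h4 h5
    have h6 := tendsto_newtonCotesApprox hm hFs (hB'c ω) 1 (het.comp hns.tendsto_atTop) h2
    have h7 := h1.comp ((tendsto_add_atTop_nat N).comp hns.tendsto_atTop)
    have h8 : (fun s => B' s ω) = fun s => B s ω := funext h3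
    rw [hF', h8] at h6
    have h9 := tendsto_nhds_unique h6 h7
    rw [h4, ← h3, h5] at h9
    have h10 : F 0 = 0 := by simp [hF]
    linarith
  have hfF : (fun b => x₀ + F b) = f := by
    refine eq_of_ae_eq_comp_gaussian (v := ((1 : ℝ≥0) : ℝ) ^ (2 * H) |>.toNNReal) (by simp)
      (hB'm 1).aemeasurable (hB'.map_eq hH.ne' 1) (continuous_const.add hFs.continuous)
      hf.continuous hsol
  have hfd : ∀ b, HasDerivAt f (σ (f b)) b := fun b => by
    rw [← hfF]
    have := (hFd b).const_add x₀
    rw [hg, ← hfF] at this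
    exact this
  have hf0 : f 0 = x₀ := by rw [← hfF]; simp [hF]
  filter_upwards [hXf t] with ω hω
  rw [hω, ← hf0]
  exact h.eq_of_hasDerivAt hL hfd _

theorem IsPathwiseSolution.ae_eq_flow {Ω : Type*} [MeasurableSpace Ω] {P : Measure Ω}
    [IsProbabilityMeasure P] {H : ℝ} (hH : 0 < H) {B X : ℝ≥0 → Ω → ℝ}
    (hB : IsFractionalBrownianMotion P H B) {σ : ℝ → ℝ} {Ψ : ℝ → ℝ → ℝ} {K : ℝ≥0}
    (h : IsFlow σ Ψ) (hL : LipschitzWith K σ)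
    (hσ : ContDiff ℝ ((⊤ : ℕ∞) : WithTop ℕ∞) σ) {x₀ : ℝ}
    (hX : IsPathwiseSolution P H σ x₀ B X) (t : ℝ≥0) :
    ∀ᵐ ω ∂P, X t ω = Ψ (B t ω) x₀ := by
  rcases hX with hX | ⟨m, hm, hmH, hX⟩
  · filter_upwards [hX, hB.ae_zero hH.ne'] with ω h1 h2
    exact h1.eq_flow h hL hσ h2 t
  · exact hX.ae_eq_flow hH hB h hL hσ hm hmH t

/-! ### Densities, relative entropy and relative Fisher information along a flow line -/

/-- A continuous function that vanishes at infinity, extended by zero along an open embedding, is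
continuous. -/
theorem Topology.IsOpenEmbedding.continuous_extend_zero {X Y : Type*} [TopologicalSpace X]
    [TopologicalSpace Y] [T2Space Y] {φ : X → Y} (hφ : IsOpenEmbedding φ) {q : X → ℝ}
    (hq : Continuous q) (h0 : Tendsto q (cocompact X) (𝓝 0)) :
    Continuous (Function.extend φ q 0) := by
  rw [continuous_iff_continuousAt]
  intro z
  by_cases hz : ∃ u, φ u = z
  · obtain ⟨u, rfl⟩ := hz
    rw [← hφ.continuousAt_iff, Function.extend_comp hφ.injective]
    exact hq.continuousAt
  · rw [ContinuousAt, Function.extend_apply' _ _ _ hz, Pi.zero_apply]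
    intro U hU
    obtain ⟨S, hS, hSU⟩ := mem_cocompact.1 (h0 hU)
    have hmem : (φ '' S)ᶜ ∈ 𝓝 z := (hS.image hφ.continuous).isClosed.isOpen_compl.mem_nhds
      fun ⟨u, _, hu⟩ => hz ⟨u, hu⟩
    rw [mem_map]
    filter_upwards [hmem] with y hy
    by_cases hy' : ∃ u, φ u = y
    · obtain ⟨u, rfl⟩ := hy'
      rw [Set.mem_preimage, hφ.injective.extend_apply]
      exact hSU fun hu => hy ⟨u, hu, rfl⟩
    · rw [Set.mem_preimage, Function.extend_apply' _ _ _ hy']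
      exact mem_of_mem_nhds hU

/-- The density of `φ (Z)` is that of `Z` divided by `|φ'|` on the range of `φ`, and zero outside;
it is continuous as soon as this quotient vanishes at infinity. -/
theorem isContinuousDensity_comp {Ω : Type*} [MeasurableSpace Ω] {P : Measure Ω} {X Z : Ω → ℝ}
    (hZ : AEMeasurable Z P) {p φ d : ℝ → ℝ} (hp : Continuous p) (hp0 : ∀ u, 0 ≤ p u)
    (hlaw : P.map Z = volume.withDensity fun u => ENNReal.ofReal (p u))
    (hφ : IsOpenEmbedding φ) (hd : ∀ u, HasDerivAt φ (d u) u) (hdc : Continuous d)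
    (hd0 : ∀ u, d u ≠ 0) (h0 : Tendsto (fun u => p u / |d u|) (cocompact ℝ) (𝓝 0))
    (hX : ∀ᵐ ω ∂P, X ω = φ (Z ω)) :
    IsContinuousDensity P X (Function.extend φ (fun u => p u / |d u|) 0) := by
  have hφZ : AEMeasurable (fun ω => φ (Z ω)) P := hφ.continuous.measurable.comp_aemeasurable hZ
  refine ⟨hφZ.congr (hX.mono fun _ h => h.symm), hφ.continuous_extend_zero
    (hp.div hdc.abs fun u => abs_ne_zero.2 (hd0 u)) h0, fun x => ?_, ?_⟩
  · by_cases hx : ∃ u, φ u = x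
    · obtain ⟨u, rfl⟩ := hx
      rw [hφ.injective.extend_apply]
      exact div_nonneg (hp0 u) (abs_nonneg _)
    · rw [Function.extend_apply' _ _ _ hx]
      exact le_rfl
  · rw [Measure.map_congr hX, show (fun ω => φ (Z ω)) = φ ∘ Z from rfl,
      ← AEMeasurable.map_map_of_aemeasurable hφ.continuous.measurable.aemeasurable hZ, hlaw]
    ext A hA
    have hA' : MeasurableSet (φ ⁻¹' A) := hφ.continuous.measurable hA
    have hr : MeasurableSet (Set.range φ) := hφ.isOpen_range.measurableSet
    rw [Measure.map_apply hφ.continuous.measurable hA, withDensity_apply _ hA',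
      withDensity_apply _ hA, ← lintegral_inter_add_sdiff _ A hr]
    have h1 : ∫⁻ x in A \ Set.range φ,
        ENNReal.ofReal (Function.extend φ (fun u => p u / |d u|) 0 x) = 0 := by
      rw [setLIntegral_congr_fun (g := fun _ => 0) (hA.diff hr), lintegral_zero]
      intro x hx
      simp only
      rw [Function.extend_apply' _ _ _ hx.2, Pi.zero_apply, ENNReal.ofReal_zero]
    rw [h1, add_zero, ← Set.image_preimage_eq_inter_range,
      lintegral_image_eq_lintegral_abs_deriv_mul hA' (fun u _ => (hd u).hasDerivWithinAt)
        hφ.injective.injOn]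
    refine setLIntegral_congr_fun hA' fun u _ => ?_
    rw [hφ.injective.extend_apply, ← ENNReal.ofReal_mul (abs_nonneg _),
      mul_div_cancel₀ _ (abs_ne_zero.2 (hd0 u))]

/-- Gaussian decay beats exponential growth. -/
theorem tendsto_gaussianPDFReal_mul_exp (c : ℝ) {v : ℝ≥0} (hv : v ≠ 0) (K : ℝ) :
    Tendsto (fun u => gaussianPDFReal c v u * Real.exp (K * |u|)) (cocompact ℝ) (𝓝 0) := by
  have hv' : (0 : ℝ) < v := by positivity
  set A : ℝ := v * (K + 1) ^ 2 + c ^ 2 / (2 * v) with hA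
  have h1 : Tendsto (fun u : ℝ => (√(2 * Real.pi * v))⁻¹ * Real.exp (A - |u|)) (cocompact ℝ)
      (𝓝 0) := by
    have h2 : Tendsto (fun u : ℝ => A - |u|) (cocompact ℝ) atBot :=
      tendsto_atBot_add_const_left _ A
        (tendsto_neg_atTop_atBot.comp (tendsto_norm_cocompact_atTop (E := ℝ)))
    simpa using (Real.tendsto_exp_atBot.comp h2).const_mul (√(2 * Real.pi * v))⁻¹
  refine squeeze_zero (fun u => mul_nonneg (gaussianPDFReal_nonneg _ _ _) (Real.exp_pos _).le)
    (fun u => ?_) h1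
  rw [gaussianPDFReal_def]
  simp only
  rw [mul_assoc, ← Real.exp_add]
  gcongr
  -- By AM–GM, `(K + 1) |u| ≤ u² / (4 v) + v (K + 1)²`, while `(u - c)² ≥ u² / 2 - c²`.
  have h3 : (u - c) ^ 2 / (2 * v) ≥ |u| ^ 2 / (4 * v) - c ^ 2 / (2 * v) := by
    rw [sq_abs, ge_iff_le, ← sub_nonneg]
    have : (u - c) ^ 2 / (2 * v) - (u ^ 2 / (4 * v) - c ^ 2 / (2 * v)) =
      (u - 2 * c) ^ 2 / (4 * v) := by field_simp; ring
    rw [this]; positivity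
  have h4 : (K + 1) * |u| ≤ |u| ^ 2 / (4 * v) + v * (K + 1) ^ 2 := by
    rw [← sub_nonneg]
    have : |u| ^ 2 / (4 * v) + v * (K + 1) ^ 2 - (K + 1) * |u| =
      (|u| - 2 * v * (K + 1)) ^ 2 / (4 * v) := by field_simp; ring
    rw [this]; positivity
  rw [neg_div, hA]
  linarith

/-- `Function.Injective.extend_apply` for a flow line, in beta-reduced form. -/
theorem IsFlow.extend_apply {σ : ℝ → ℝ} {Ψ : ℝ → ℝ → ℝ} {K : ℝ≥0} (h : IsFlow σ Ψ)
    (hL : LipschitzWith K σ) {y : ℝ} (hy : σ y ≠ 0) (q : ℝ → ℝ) (u : ℝ) :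
    Function.extend (fun u => Ψ u y) q 0 (Ψ u y) = q u :=
  (h.injective hL hy).extend_apply q 0 u

/-- The density of the flow line through `y`, run for a Gaussian time. -/
theorem IsFlow.isContinuousDensity {Ω : Type*} [MeasurableSpace Ω] {P : Measure Ω} {X Z : Ω → ℝ}
    {σ : ℝ → ℝ} {Ψ : ℝ → ℝ → ℝ} {K : ℝ≥0} (h : IsFlow σ Ψ) (hL : LipschitzWith K σ) {y : ℝ}
    (hy : σ y ≠ 0) {c : ℝ} {v : ℝ≥0} (hv : v ≠ 0) (hZ : AEMeasurable Z P)
    (hlaw : P.map Z = gaussianReal c v) (hX : ∀ᵐ ω ∂P, X ω = Ψ (Z ω) y) :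
    IsContinuousDensity P X (Function.extend (fun u => Ψ u y)
      (fun u => gaussianPDFReal c v u / |σ (Ψ u y)|) 0) := by
  have hpc : Continuous (gaussianPDFReal c v) := by
    rw [gaussianPDFReal_def]; fun_prop
  refine isContinuousDensity_comp hZ hpc (gaussianPDFReal_nonneg c v) ?_
    (h.isOpenEmbedding hL hy) (fun u => h.hasDerivAt u y) (hL.continuous.comp (h.continuous y))
    (h.field_ne_zero hL hy) ?_ hX
  · rw [hlaw, gaussianReal_of_var_ne_zero c hv]
    rfl
  · have h1 := (tendsto_gaussianPDFReal_mul_exp c hv K).mul_const (|σ y|⁻¹)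
    rw [zero_mul] at h1
    refine squeeze_zero (fun u => div_nonneg (gaussianPDFReal_nonneg _ _ _) (abs_nonneg _))
      (fun u => ?_) h1
    have h2 := h.abs_field_le_exp_mul hL u y
    have h3 : 0 < |σ (Ψ u y)| := abs_pos.2 (h.field_ne_zero hL hy u)
    have h4 : 0 < |σ y| := abs_pos.2 hy
    rw [mul_assoc, div_eq_mul_inv]
    refine mul_le_mul_of_nonneg_left ?_ (gaussianPDFReal_nonneg _ _ _)
    rw [← div_eq_mul_inv, inv_eq_one_div, div_le_div_iff₀ h3 h4, one_mul]
    exact h2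

theorem log_gaussianPDFReal_div (c : ℝ) {v : ℝ≥0} (hv : v ≠ 0) (u : ℝ) :
    Real.log (gaussianPDFReal 0 v u / gaussianPDFReal c v u) = (c ^ 2 - 2 * u * c) / (2 * v) := by
  have hv' : (0 : ℝ) < v := by positivity
  simp only [gaussianPDFReal_def]
  rw [mul_div_mul_left _ _ (by positivity), ← Real.exp_sub, Real.log_exp]
  field_simp
  ring

/-- `X` and `Y` are the positions on one flow line at the Gaussian times `Z` and `Z + c`, where
`Z` has variance `v`. -/
structure IsGaussianPair {Ω : Type*} [MeasurableSpace Ω] (P : Measure Ω) (φ : ℝ → ℝ) (c : ℝ)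
    (v : ℝ≥0) (Z X Y : Ω → ℝ) : Prop where
  aemeasurable : AEMeasurable Z P
  map_eq : P.map Z = gaussianReal 0 v
  left : ∀ᵐ ω ∂P, X ω = φ (Z ω)
  right : ∀ᵐ ω ∂P, Y ω = φ (Z ω + c)

namespace IsGaussianPair

variable {Ω : Type*} [MeasurableSpace Ω] {P : Measure Ω} {σ : ℝ → ℝ} {Ψ : ℝ → ℝ → ℝ} {K : ℝ≥0}
  {y c : ℝ} {v : ℝ≥0} {Z X Y : Ω → ℝ}

theorem isContinuousDensity_left (h : IsGaussianPair P (fun u => Ψ u y) c v Z X Y)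
    (hΨ : IsFlow σ Ψ) (hL : LipschitzWith K σ) (hy : σ y ≠ 0) (hv : v ≠ 0) :
    IsContinuousDensity P X (Function.extend (fun u => Ψ u y)
      (fun u => gaussianPDFReal 0 v u / |σ (Ψ u y)|) 0) :=
  hΨ.isContinuousDensity hL hy hv h.aemeasurable h.map_eq h.left

theorem isContinuousDensity_right (h : IsGaussianPair P (fun u => Ψ u y) c v Z X Y)
    (hΨ : IsFlow σ Ψ) (hL : LipschitzWith K σ) (hy : σ y ≠ 0) (hv : v ≠ 0) :
    IsContinuousDensity P Y (Function.extend (fun u => Ψ u y)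
      (fun u => gaussianPDFReal c v u / |σ (Ψ u y)|) 0) := by
  refine hΨ.isContinuousDensity hL hy hv (h.aemeasurable.add_const c) ?_ h.right
  have h1 := AEMeasurable.map_map_of_aemeasurable (μ := P) (f := Z) (g := fun x => x + c)
    (by fun_prop) h.aemeasurable
  rw [h.map_eq, gaussianReal_map_add_const, zero_add] at h1
  exact h1.symm

theorem densityOf_left_pos (h : IsGaussianPair P (fun u => Ψ u y) c v Z X Y)
    (hΨ : IsFlow σ Ψ) (hL : LipschitzWith K σ) (hy : σ y ≠ 0) (hv : v ≠ 0) (u : ℝ) :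
    0 < densityOf P X (Ψ u y) := by
  rw [(h.isContinuousDensity_left hΨ hL hy hv).densityOf_eq,
    hΨ.extend_apply hL hy]
  exact div_pos (gaussianPDFReal_pos _ _ _ hv) (abs_pos.2 (hΨ.field_ne_zero hL hy u))

theorem densityOf_right_pos (h : IsGaussianPair P (fun u => Ψ u y) c v Z X Y)
    (hΨ : IsFlow σ Ψ) (hL : LipschitzWith K σ) (hy : σ y ≠ 0) (hv : v ≠ 0) (u : ℝ) :
    0 < densityOf P Y (Ψ u y) := by
  rw [(h.isContinuousDensity_right hΨ hL hy hv).densityOf_eq,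
    hΨ.extend_apply hL hy]
  exact div_pos (gaussianPDFReal_pos _ _ _ hv) (abs_pos.2 (hΨ.field_ne_zero hL hy u))

/-- The Jacobian cancels in the likelihood ratio, which is therefore the Gaussian one read in the
flow coordinate. -/
theorem logRatio_eq (h : IsGaussianPair P (fun u => Ψ u y) c v Z X Y)
    (hΨ : IsFlow σ Ψ) (hL : LipschitzWith K σ) (hy : σ y ≠ 0) (hv : v ≠ 0) (u : ℝ) :
    logRatio P X Y (Ψ u y) = (c ^ 2 - 2 * u * c) / (2 * v) := by
  rw [logRatio, (h.isContinuousDensity_left hΨ hL hy hv).densityOf_eq,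
    (h.isContinuousDensity_right hΨ hL hy hv).densityOf_eq,
    hΨ.extend_apply hL hy, hΨ.extend_apply hL hy,
    div_div_div_cancel_right₀ (abs_ne_zero.2 (hΨ.field_ne_zero hL hy u)),
    log_gaussianPDFReal_div c hv]

theorem hasDerivAt_logRatio (h : IsGaussianPair P (fun u => Ψ u y) c v Z X Y)
    (hΨ : IsFlow σ Ψ) (hL : LipschitzWith K σ) (hy : σ y ≠ 0) (hv : v ≠ 0) (u : ℝ) :
    HasDerivAt (logRatio P X Y) (-(c / v) / σ (Ψ u y)) (Ψ u y) := by
  have hv' : (v : ℝ) ≠ 0 := by positivity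
  have hφ := hΨ.isOpenEmbedding hL hy
  set e := hφ.toOpenPartialHomeomorph (fun u => Ψ u y) with he
  have hsymm : ∀ b, e.symm (Ψ b y) = b := fun b => hφ.toOpenPartialHomeomorph_left_inv
  have hmem : Ψ u y ∈ e.target := by
    rw [he, hφ.toOpenPartialHomeomorph_target]; exact ⟨u, rfl⟩
  have h1 : HasDerivAt e.symm (σ (Ψ u y))⁻¹ (Ψ u y) :=
    e.hasDerivAt_symm hmem (hΨ.field_ne_zero hL hy u) (by
      rw [hsymm]; exact hΨ.hasDerivAt u y)
  have h2 := ((h1.const_mul (2 : ℝ)).mul_const c).const_sub (c ^ 2) |>.div_const (2 * (v : ℝ))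
  refine (h2.congr_deriv ?_).congr_of_eventuallyEq ?_
  · field_simp
  · filter_upwards [hφ.isOpen_range.mem_nhds ⟨u, rfl⟩] with z hz
    obtain ⟨b, rfl⟩ := hz
    simp only
    rw [h.logRatio_eq hΨ hL hy hv, hsymm]

theorem ae_logRatio_eq (h : IsGaussianPair P (fun u => Ψ u y) c v Z X Y)
    (hΨ : IsFlow σ Ψ) (hL : LipschitzWith K σ) (hy : σ y ≠ 0) (hv : v ≠ 0) :
    (fun ω => logRatio P X Y (X ω)) =ᵐ[P] fun ω => (c ^ 2 - 2 * Z ω * c) / (2 * v) := by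
  filter_upwards [h.left] with ω hω
  rw [hω, h.logRatio_eq hΨ hL hy hv]

theorem integrable (h : IsGaussianPair P (fun u => Ψ u y) c v Z X Y) : Integrable Z P := by
  have h1 : Integrable id (P.map Z) := by
    rw [h.map_eq]
    exact (memLp_id_gaussianReal 1).integrable le_rfl
  exact h1.comp_aemeasurable h.aemeasurable

theorem integrable_logRatio [IsProbabilityMeasure P]
    (h : IsGaussianPair P (fun u => Ψ u y) c v Z X Y)
    (hΨ : IsFlow σ Ψ) (hL : LipschitzWith K σ) (hy : σ y ≠ 0) (hv : v ≠ 0) :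
    Integrable (fun ω => logRatio P X Y (X ω)) P := by
  refine Integrable.congr ?_ (h.ae_logRatio_eq hΨ hL hy hv).symm
  exact ((integrable_const _).sub ((h.integrable.const_mul 2).mul_const c)).div_const _

theorem klDivergence_eq [IsProbabilityMeasure P]
    (h : IsGaussianPair P (fun u => Ψ u y) c v Z X Y)
    (hΨ : IsFlow σ Ψ) (hL : LipschitzWith K σ) (hy : σ y ≠ 0) (hv : v ≠ 0) :
    klDivergence P X Y = c ^ 2 / (2 * v) := by
  have h0 : ∫ ω, Z ω ∂P = 0 := by
    have h1 := integral_map h.aemeasurable (f := fun x : ℝ => x)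
      aestronglyMeasurable_id
    rw [← h1, h.map_eq, integral_id_gaussianReal]
  rw [klDivergence, integral_congr_ae (h.ae_logRatio_eq hΨ hL hy hv), integral_div,
    integral_sub (integrable_const _) ((h.integrable.const_mul 2).mul_const c),
    integral_mul_const, integral_const_mul, h0]
  simp

theorem ae_fisher_eq (h : IsGaussianPair P (fun u => Ψ u y) c v Z X Y)
    (hΨ : IsFlow σ Ψ) (hL : LipschitzWith K σ) (hy : σ y ≠ 0) (hv : v ≠ 0) :
    (fun ω => σ (X ω) ^ 2 * (deriv (logRatio P X Y) (X ω)) ^ 2) =ᵐ[P]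
      fun _ => (c / v) ^ 2 := by
  filter_upwards [h.left] with ω hω
  have h1 := hΨ.field_ne_zero hL hy (Z ω)
  rw [hω, (h.hasDerivAt_logRatio hΨ hL hy hv (Z ω)).deriv, ← mul_pow,
    mul_div_cancel₀ _ h1, neg_sq]

theorem relativeFisherInfo_eq [IsProbabilityMeasure P]
    (h : IsGaussianPair P (fun u => Ψ u y) c v Z X Y)
    (hΨ : IsFlow σ Ψ) (hL : LipschitzWith K σ) (hy : σ y ≠ 0) (hv : v ≠ 0) :
    relativeFisherInfo P (fun x => σ x ^ 2) X Y = (c / v) ^ 2 := by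
  rw [relativeFisherInfo, integral_congr_ae (h.ae_fisher_eq hΨ hL hy hv)]
  simp

end IsGaussianPair

theorem theorem2p3 {Ω : Type*} [MeasurableSpace Ω] (P : Measure Ω) [IsProbabilityMeasure P]
    (H : ℝ) (hH0 : 0 < H) (hH1 : H < 1)
    (B : ℝ≥0 → Ω → ℝ) (hB : IsFractionalBrownianMotion P H B)
    (σ : ℝ → ℝ) (hσ : ContDiff ℝ (((⊤ : ℕ∞)) : WithTop ℕ∞) σ)
    (hσb : ∀ k : ℕ, 1 ≤ k → ∃ C : ℝ, ∀ x, |iteratedDeriv k σ x| ≤ C)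
    (x₀ y₀ : ℝ) (hσ0 : ∀ z ∈ Set.uIcc x₀ y₀, σ z ≠ 0)
    (X Y : ℝ≥0 → Ω → ℝ)
    (hX : IsPathwiseSolution P H σ x₀ B X) (hY : IsPathwiseSolution P H σ y₀ B Y) :
    (∀ t : ℝ≥0, 0 < t →
      -- the densities exist, and `K` and `J` are given by convergent integrals
      (∃ f, IsContinuousDensity P (X t) f) ∧ (∃ g, IsContinuousDensity P (Y t) g) ∧
      Integrable (fun ω => logRatio P (X t) (Y t) (X t ω)) P ∧
      (∀ᵐ ω ∂P, 0 < densityOf P (X t) (X t ω) ∧ 0 < densityOf P (Y t) (X t ω) ∧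
        DifferentiableAt ℝ (logRatio P (X t) (Y t)) (X t ω)) ∧
      Integrable (fun ω => σ (X t ω) ^ 2 * (deriv (logRatio P (X t) (Y t)) (X t ω)) ^ 2) P ∧
      HasDerivAt (fun s : ℝ => klDivergence P (X s.toNNReal) (Y s.toNNReal))
        (-(H * (t : ℝ) ^ (2 * H - 1) *
          relativeFisherInfo P (fun x => σ x ^ 2) (X t) (Y t))) (t : ℝ)) ∧
    AntitoneOn (fun t : ℝ≥0 => klDivergence P (X t) (Y t)) (Set.Ioi 0) := by
  obtain ⟨C, hC⟩ := hσb 1 le_rfl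
  have hL : LipschitzWith C.toNNReal σ :=
    lipschitzWith_of_nnnorm_deriv_le (hσ.differentiable (by simp)) fun x => by
      rw [← NNReal.coe_le_coe, coe_nnnorm, Real.norm_eq_abs, ← iteratedDeriv_one]
      exact (hC x).trans (Real.le_coe_toNNReal C)
  obtain ⟨Ψ, hΨ⟩ := exists_isFlow hL (contDiff_infty.1 hσ 1)
  have hx₀ : σ x₀ ≠ 0 := hσ0 x₀ Set.left_mem_uIcc
  obtain ⟨c, hc⟩ := hΨ.exists_eq hL hσ0
  have hv : ∀ t : ℝ≥0, 0 < t → ((t : ℝ) ^ (2 * H)).toNNReal ≠ 0 := fun t ht =>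
    (Real.toNNReal_pos.2 (Real.rpow_pos_of_pos (NNReal.coe_pos.2 ht) _)).ne'
  have hvc : ∀ t : ℝ≥0, (((t : ℝ) ^ (2 * H)).toNNReal : ℝ) = (t : ℝ) ^ (2 * H) := fun t =>
    Real.coe_toNNReal _ (by positivity)
  have hpair : ∀ t : ℝ≥0, IsGaussianPair P (fun u => Ψ u x₀) c ((t : ℝ) ^ (2 * H)).toNNReal
      (B t) (X t) (Y t) := fun t =>
    { aemeasurable := hB.isGaussianProcess.aemeasurable t
      map_eq := hB.map_eq hH0.ne' t
      left := hX.ae_eq_flow hH0 hB hΨ hL hσ t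
      right := by
        filter_upwards [hY.ae_eq_flow hH0 hB hΨ hL hσ t] with ω hω
        rw [hω, hΨ.add hL, hc] }
  have hK : ∀ t : ℝ≥0, 0 < t → klDivergence P (X t) (Y t) = c ^ 2 / (2 * (t : ℝ) ^ (2 * H)) :=
    fun t ht => by rw [(hpair t).klDivergence_eq hΨ hL hx₀ (hv t ht), hvc]
  refine ⟨fun t ht => ?_, fun s hs t ht hst => ?_⟩
  · have ht' : (0 : ℝ) < t := NNReal.coe_pos.2 ht
    have hp := hpair t
    refine ⟨⟨_, hp.isContinuousDensity_left hΨ hL hx₀ (hv t ht)⟩,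
      ⟨_, hp.isContinuousDensity_right hΨ hL hx₀ (hv t ht)⟩,
      hp.integrable_logRatio hΨ hL hx₀ (hv t ht), ?_, ?_, ?_⟩
    · filter_upwards [hp.left] with ω hω
      rw [hω]
      exact ⟨hp.densityOf_left_pos hΨ hL hx₀ (hv t ht) _,
        hp.densityOf_right_pos hΨ hL hx₀ (hv t ht) _,
        (hp.hasDerivAt_logRatio hΨ hL hx₀ (hv t ht) _).differentiableAt⟩
    · exact (integrable_const _).congr (hp.ae_fisher_eq hΨ hL hx₀ (hv t ht)).symm
    · rw [hp.relativeFisherInfo_eq hΨ hL hx₀ (hv t ht), hvc]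
      have h1 := ((Real.hasDerivAt_rpow_const (x := (t : ℝ)) (p := -(2 * H))
        (Or.inl ht'.ne')).const_mul (c ^ 2 / 2))
      refine (h1.congr_deriv ?_).congr_of_eventuallyEq ?_
      · rw [show -(2 * H) - 1 = (2 * H - 1) - 2 * H - 2 * H by ring, Real.rpow_sub ht',
          Real.rpow_sub ht']
        have : (t : ℝ) ^ (2 * H) ≠ 0 := (Real.rpow_pos_of_pos ht' _).ne'
        field_simp
      · filter_upwards [Ioi_mem_nhds ht'] with s hs
        rw [hK _ (Real.toNNReal_pos.2 hs), Real.coe_toNNReal _ (le_of_lt hs),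
          Real.rpow_neg (le_of_lt hs)]
        field_simp
  · simp only
    rw [hK t ht, hK s hs]
    have hs' : (0 : ℝ) < s := NNReal.coe_pos.2 hs
    have hst' : (s : ℝ) ≤ t := hst
    gcongr
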